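/- Let $K,L\ge 0$ and $n=K+L+1$, and let $\mu=(K+1,1^L)$ be the hook partition of $n$. Let $\mathbb k$ be a field of characteristic $0$, and put $$\Delta_\mu=\det\bigl(x_i^{p_j}y_i^{q_j}\bigr)_{1\le i,j\le n}\in\mathbb k[x_1,\dots,x_n,y_1,\dots,y_n],$$ where $(p_1,q_1),\dots,(p_n,q_n)$ are the biexponents of $\mu$ in lexicographic order, i.e. the pairs $(0,0),(0,1),\dots,(0,K),(1,0),\dots,(L,0)$. A *dessin* attached to $\mu$ consists of $n-1$ columns, at places $1,\dots,n-1$ from left to right, some of whose cells are crossed, the others being white. Exactly $K$ of the columns are $y$-columns, drawn above an axis, and their heights from left to right are $K,K-1,\dots,1$; the other $L$ are $x$-columns, drawn below the axis, and their depths from left to right are $L,L-1,\dots,1$; the $x$- and $y$-columns may be interleaved in any way. In each column the crossed cells are those nearest to the axis. A column is called *uniform* if all its cells are crossed or all its cells are white. The number of crosses in an $x$-column is arbitrary (from $0$ to its depth). The number of crosses in a $y$-column with no $x$-column to its right is arbitrary (from $0$ to its height). For any other $y$-column, consider the first uniform $x$-column to its right (there is one, since the $x$-column of depth $1$ is always uniform):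 if it is entirely white, the $y$-column must contain at least one crossed cell; if it is entirely crossed, the $y$-column must contain at least one white cell. For a dessin let $S$ be its set of crossed cells, and let $\mathcal S$ be the set of all the sets $S$ obtained from the dessins attached to $\mu$. For $S\in\mathcal S$ let $$\partial_S=\prod_{i=1}^{n-1}\partial_{x_i}^{a_i}\partial_{y_i}^{b_i},$$ where $a_i$ (resp. $b_i$) is the number of cells of $S$ that lie in an $x$-column (resp. a $y$-column) at place $i$. **Theorem.** The family $\{\partial_S\Delta_\mu\}_{S\in\mathcal S}$ is linearly independent over $\mathbb k$. -/

import Mathlib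

open MvPolynomial

/-- The hook partition `(K + 1, 1 ^ L)`, as a Young diagram. -/
def hook (K L : ℕ) : YoungDiagram :=
  YoungDiagram.ofRowLens ((K + 1) :: List.replicate L 1) (by
    rw [List.sortedGE_iff_pairwise, List.pairwise_cons]
    refine ⟨fun a ha => ?_, ?_⟩
    · rw [List.eq_of_mem_replicate ha]; omega
    · exact List.pairwise_replicate.2 (Or.inr le_rfl))

theorem hook_cells (K L : ℕ) :
    (hook K L).cells =
      (Finset.range (K + 1)).image (fun j => ((0 : ℕ), j)) ∪
        (Finset.range L).image (fun i => (i + 1, (0 : ℕ))) := by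
  ext ⟨i, j⟩
  rw [YoungDiagram.mem_cells, hook, YoungDiagram.mem_ofRowLens]
  rcases i with _ | i
  · simp
  · simp only [List.length_cons, List.length_replicate, List.getElem_cons_succ,
      List.getElem_replicate, Finset.mem_union, Finset.mem_image, Finset.mem_range,
      Prod.mk.injEq]
    constructor
    · rintro ⟨h, hj⟩
      exact Or.inr ⟨i, by omega, rfl, by omega⟩
    · rintro (⟨a, -, h, -⟩ | ⟨a, ha, h1, h2⟩)
      · omega
      · exact ⟨by omega, by omega⟩

theorem hook_card (K L : ℕ) : (hook K L).card = K + L + 1 := by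
  unfold YoungDiagram.card
  rw [hook_cells, Finset.card_union_of_disjoint, Finset.card_image_of_injective,
    Finset.card_image_of_injective, Finset.card_range, Finset.card_range]
  · omega
  · intro a b h; simpa using h
  · intro a b h; simpa using h
  · rw [Finset.disjoint_left]
    intro c h1 h2
    simp only [Finset.mem_image] at h1 h2
    obtain ⟨a, -, rfl⟩ := h1
    obtain ⟨b, -, h⟩ := h2
    simp at h

/-- The `n` biexponents `(p, q)` of a partition `μ` of `n` (the cell in row `p` and column `q`, both
counted from `0`), listed in increasing lexicographic order. -/
def biexponent (μ : YoungDiagram) {n : ℕ} (hn : μ.card = n) (j : Fin n) : ℕ × ℕ :=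
  ofLex ((μ.cells.map toLex.toEmbedding).orderEmbOfFin
    ((Finset.card_map _).trans hn) j)

/-- The polynomial `Δ_μ = det (x_i ^ p_j * y_i ^ q_j)`; the variable `x_i` is `X (Sum.inl i)` and
the variable `y_i` is `X (Sum.inr i)`. -/
noncomputable def Delta (𝕜 : Type*) [Field 𝕜] (μ : YoungDiagram) {n : ℕ} (hn : μ.card = n) :
    MvPolynomial (Fin n ⊕ Fin n) 𝕜 :=
  Matrix.det (Matrix.of fun i j : Fin n =>
    (X (Sum.inl i) : MvPolynomial (Fin n ⊕ Fin n) 𝕜) ^ (biexponent μ hn j).1 *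
      X (Sum.inr i) ^ (biexponent μ hn j).2)

/-- The size of the column at place `i`, when the `y`-columns stand exactly at the places in `Y`:
among the columns of the same kind (`x` or `y`) the sizes decrease from left to right down to `1`,
so the size is the number of columns of that kind at the places `j ≥ i`. -/
def columnSize {m : ℕ} (Y : Finset (Fin m)) (i : Fin m) : ℕ :=
  (Finset.univ.filter fun j : Fin m => i ≤ j ∧ (j ∈ Y ↔ i ∈ Y)).card

/-- A column is uniform if it contains only crossed cells or only white cells; here `c j` is the
number of crosses in column `j`. -/
def IsUniform {m : ℕ} (Y : Finset (Fin m)) (c : Fin m → ℕ) (j : Fin m) : Prop :=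
  c j = 0 ∨ c j = columnSize Y j

/-- `j` is the first place to the right of `i` that carries a uniform `x`-column. -/
def IsFirstUniformX {m : ℕ} (Y : Finset (Fin m)) (c : Fin m → ℕ) (i j : Fin m) : Prop :=
  i < j ∧ j ∉ Y ∧ IsUniform Y c j ∧
    ∀ k : Fin m, i < k → k < j → k ∉ Y → ¬ IsUniform Y c k

/-- A dessin (with crosses) attached to the hook `(K + 1, 1 ^ L)`. Its `K + L` places carry `K`
`y`-columns of heights `K, …, 1` and `L` `x`-columns of depths `L, …, 1`, from left to right. -/
structure Dessin (K L : ℕ) where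
  /-- the places of the `y`-columns; the `x`-columns are at the other places -/
  yPlaces : Finset (Fin (K + L))
  card_yPlaces : yPlaces.card = K
  /-- the number of crosses in each column -/
  crosses : Fin (K + L) → ℕ
  crosses_le : ∀ i, crosses i ≤ columnSize yPlaces i
  /-- if the first uniform `x`-column to the right of a `y`-column is white, then the `y`-column
  has at least one cross -/
  pos_of_white : ∀ i ∈ yPlaces, ∀ j, IsFirstUniformX yPlaces crosses i j →
    crosses j = 0 → 1 ≤ crosses i
  /-- if the first uniform `x`-column to the right of a `y`-column is full of crosses, then the
  `y`-column has at least one white cell -/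
  lt_of_full : ∀ i ∈ yPlaces, ∀ j, IsFirstUniformX yPlaces crosses i j →
    crosses j = columnSize yPlaces j → crosses i < columnSize yPlaces i

/-- A cell on `m` places: `(Sum.inl i, t)` is the cell of an `x`-column at place `i` and
`(Sum.inr i, t)` is the cell of a `y`-column at place `i`, at distance `t` from the axis. -/
abbrev DessinCell (m : ℕ) : Type := (Fin m ⊕ Fin m) × ℕ

/-- The set `S` of crossed cells of a dessin; the crosses are placed next to the axis. -/
def Dessin.crossedCells {K L : ℕ} (D : Dessin K L) : Finset (DessinCell (K + L)) :=
  Finset.univ.biUnion fun i : Fin (K + L) =>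
    (Finset.range (D.crosses i)).image fun t =>
      (if i ∈ D.yPlaces then Sum.inr i else Sum.inl i, t)

/-- The set `𝒮` of the sets of crossed cells of all dessins. -/
def crossedCellSets (K L : ℕ) : Set (Finset (DessinCell (K + L))) :=
  Set.range Dessin.crossedCells

/-- The number of cells of `S` in the `x`-column (`v = Sum.inl i`) or the `y`-column
(`v = Sum.inr i`) at place `i`. -/
def cellCount {m : ℕ} (S : Finset (DessinCell m)) (v : Fin m ⊕ Fin m) : ℕ :=
  (S.filter fun c => c.1 = v).card

/-- The operator `∂_S` on polynomials in `x_1, …, x_{m+1}, y_1, …, y_{m+1}`: one derivation with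
respect to `x_i` (resp. `y_i`) for every `x`-cell (resp. `y`-cell) of `S` at place `i`. The places
`1, …, m` index the first `m` variables of each kind. -/
noncomputable def derivOp (𝕜 : Type*) [Field 𝕜] {m : ℕ} (S : Finset (DessinCell m)) :
    Module.End 𝕜 (MvPolynomial (Fin (m + 1) ⊕ Fin (m + 1)) 𝕜) :=
  ((List.finRange m).map fun i : Fin m =>
    ((pderiv (Sum.inl i.castSucc) :
        Derivation 𝕜 (MvPolynomial (Fin (m + 1) ⊕ Fin (m + 1)) 𝕜) _) :
      Module.End 𝕜 (MvPolynomial (Fin (m + 1) ⊕ Fin (m + 1)) 𝕜)) ^ cellCount S (Sum.inl i) *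
    ((pderiv (Sum.inr i.castSucc) :
        Derivation 𝕜 (MvPolynomial (Fin (m + 1) ⊕ Fin (m + 1)) 𝕜) _) :
      Module.End 𝕜 (MvPolynomial (Fin (m + 1) ⊕ Fin (m + 1)) 𝕜)) ^ cellCount S (Sum.inr i)).prod

/-! Pair polynomials by ⟨F, f⟩ = (F(∂) f)(0) and let Λ be the pairing with Δ_μ. Multiplication is
adjoint to differentiation, so ⟨T, ∂_S Δ_μ⟩ = Λ(M_S T), where M_S is the monomial of ∂_S. Compare
monomials lexicographically, place by place from the left, the x-exponent before the y-exponent. It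
suffices to find for each S ∈ 𝒮 some T with Λ(M_S T) ≠ 0 that kills every larger S'
(`exists_separating`); a linear relation is then contradicted at its smallest term.

T is built column by column. Λ is antisymmetric, kills x^(l+1), y^(k+1) and xy at every place, and
is non-zero on arrangements of the cells of the hook. Completing the exponent of a column to x^l or
y^k leaves a functional of the same kind for a hook with one cell less (`mul_x`, `mul_y`). Larger
exponents die, with one exception: a full y-column needs no completion, so nothing in T forbids an x
there.

If no x-column follows, this x dies anyway. Otherwise the first uniform x-column j to the right is
white, by the dessin condition. Let G consist of j and the full y-columns from the current place up
to j, and multiply by h_l(x_G), the complete symmetric polynomial, l being the top x-exponent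
(`mul_completeX`). A y at a place of G deletes that place from h_l, because xy dies. Hence if all
places of G but one carry y, h_l reduces to x^l at the remaining one. Moreover x_g h_l(x_G) is
killed for g ∈ G (`completeX_kill`), which removes the exception. The last pending place is the
white column j, which absorbs x^l (`close`). The x-columns met before j are not uniform, so they fit
under the lowered bound l - 1. -/

/-! ### Complete symmetric polynomials. -/

section CompleteSymmetric

variable {ι 𝕜 : Type*} [Field 𝕜]

/-- The complete homogeneous symmetric polynomial of degree `t` in the variables `x_p`, `p ∈ P`. -/
noncomputable def completeX (𝕜 : Type*) [Field 𝕜] (P : Finset ι) (t : ℕ) :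
    MvPolynomial (ι ⊕ ι) 𝕜 :=
  PowerSeries.coeff t
    (∏ p ∈ P, PowerSeries.mk fun k => (X (Sum.inl p) : MvPolynomial (ι ⊕ ι) 𝕜) ^ k)

theorem completeX_empty {t : ℕ} (ht : t ≠ 0) : completeX 𝕜 (∅ : Finset ι) t = 0 := by
  simp [completeX, PowerSeries.coeff_one, ht]

theorem completeX_singleton (p : ι) (t : ℕ) :
    completeX 𝕜 {p} t = X (Sum.inl p) ^ t := by
  simp [completeX]

variable [DecidableEq ι]

/-- The simultaneous exchange of `x_u`, `x_v` and of `y_u`, `y_v`. -/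
noncomputable def exchange (𝕜 : Type*) [Field 𝕜] (u v : ι) :
    MvPolynomial (ι ⊕ ι) 𝕜 →ₐ[𝕜] MvPolynomial (ι ⊕ ι) 𝕜 :=
  rename (Sum.map (Equiv.swap u v) (Equiv.swap u v))

@[simp]
theorem exchange_inl (u v p : ι) :
    exchange 𝕜 u v (X (Sum.inl p)) = X (Sum.inl (Equiv.swap u v p)) := by
  simp [exchange]

@[simp]
theorem exchange_inr (u v p : ι) :
    exchange 𝕜 u v (X (Sum.inr p)) = X (Sum.inr (Equiv.swap u v p)) := by
  simp [exchange]

theorem completeX_insert {q : ι} {P : Finset ι} (hq : q ∉ P) (t : ℕ) :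
    completeX 𝕜 (insert q P) (t + 1) =
      completeX 𝕜 P (t + 1) + X (Sum.inl q) * completeX 𝕜 (insert q P) t := by
  have hgeom : (PowerSeries.mk fun k => (X (Sum.inl q) : MvPolynomial (ι ⊕ ι) 𝕜) ^ k) =
      1 + PowerSeries.C (X (Sum.inl q)) * PowerSeries.X *
        PowerSeries.mk fun k => (X (Sum.inl q) : MvPolynomial (ι ⊕ ι) 𝕜) ^ k := by
    ext1 n
    rcases n with _ | n
    · simp [mul_assoc]
    · simp [mul_assoc, PowerSeries.coeff_succ_X_mul, PowerSeries.coeff_one, pow_succ']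
  unfold completeX
  rw [Finset.prod_insert hq]
  conv_lhs => rw [hgeom]
  rw [add_mul, one_mul, map_add, mul_assoc, mul_assoc, PowerSeries.coeff_C_mul,
    PowerSeries.coeff_succ_X_mul]

/-- Expand the polynomial of degree t + 1 in all the variables by splitting off u, then v, and
subtract. -/
theorem sub_mul_completeX {u v : ι} {P : Finset ι} (huv : u ≠ v) (hu : u ∉ P) (hv : v ∉ P)
    (t : ℕ) :
    (X (Sum.inl u) - X (Sum.inl v)) * completeX 𝕜 (insert u (insert v P)) t =
      completeX 𝕜 (insert u P) (t + 1) - completeX 𝕜 (insert v P) (t + 1) := by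
  have h1 := completeX_insert (𝕜 := 𝕜) (q := u) (P := insert v P) (by simp [huv, hu]) t
  have h2 := completeX_insert (𝕜 := 𝕜) (q := v) (P := insert u P) (by simp [huv.symm, hv]) t
  rw [Finset.insert_comm v u P] at h2
  linear_combination h2 - h1

theorem exchange_completeX (u v : ι) (P : Finset ι) (h : u ∈ P ↔ v ∈ P) (t : ℕ) :
    exchange 𝕜 u v (completeX 𝕜 P t) = completeX 𝕜 P t := by
  have hP : P.map (Equiv.swap u v).toEmbedding = P := by
    ext p
    rw [Finset.mem_map_equiv, Equiv.symm_swap, Equiv.swap_apply_def]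
    split_ifs with h1 h2
    · subst h1; exact h.symm
    · subst h2; exact h
    · rfl
  have hmap : (exchange 𝕜 u v (completeX 𝕜 P t)) =
      PowerSeries.coeff t (PowerSeries.map (exchange 𝕜 u v).toRingHom
        (∏ p ∈ P, PowerSeries.mk fun k => (X (Sum.inl p) : MvPolynomial (ι ⊕ ι) 𝕜) ^ k)) := by
    rw [PowerSeries.coeff_map]; rfl
  rw [hmap, map_prod]
  conv_rhs => rw [completeX, ← hP, Finset.prod_map]
  congr 1
  refine Finset.prod_congr rfl fun p _ => ?_
  ext1 n
  simp

end CompleteSymmetric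

/-! ### Vanishing criteria for antisymmetric functionals. -/

section Functionals

variable {ι 𝕜 : Type*} [Field 𝕜]

/-- The monomial `x_p ^ a * y_p ^ b`, where `w = (a, b)`. -/
noncomputable def token (𝕜 : Type*) [Field 𝕜] (p : ι) (w : ℕ × ℕ) : MvPolynomial (ι ⊕ ι) 𝕜 :=
  X (Sum.inl p) ^ w.1 * X (Sum.inr p) ^ w.2

theorem linearMap_eq_zero_of_tokens [Fintype ι] (φ : MvPolynomial (ι ⊕ ι) 𝕜 →ₗ[𝕜] 𝕜)
    (h : ∀ v : ι → ℕ × ℕ, φ (∏ p, token 𝕜 p (v p)) = 0) (F : MvPolynomial (ι ⊕ ι) 𝕜) :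
    φ F = 0 := by
  induction F using MvPolynomial.induction_on' with
  | monomial m a =>
    have key : monomial m a = a • ∏ p, token 𝕜 p (m (Sum.inl p), m (Sum.inr p)) := by
      rw [monomial_eq, Finsupp.prod_fintype _ _ (fun _ => pow_zero _), Fintype.prod_sum_type,
        ← Finset.prod_mul_distrib, smul_eq_C_mul]
      rfl
    rw [key, map_smul, h, smul_zero]
  | add F G hF hG => rw [map_add, hF, hG, add_zero]

variable [DecidableEq ι]

theorem exchange_token (u v p : ι) (w : ℕ × ℕ) :
    exchange 𝕜 u v (token 𝕜 p w) = token 𝕜 (Equiv.swap u v p) w := by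
  simp [token]

theorem exchange_token_of_ne {u v p : ι} (hu : p ≠ u) (hv : p ≠ v) (w : ℕ × ℕ) :
    exchange 𝕜 u v (token 𝕜 p w) = token 𝕜 p w := by
  rw [exchange_token, Equiv.swap_apply_of_ne_of_ne hu hv]

theorem exchange_X_pow_inl {u v p : ι} (hu : p ≠ u) (hv : p ≠ v) (a : ℕ) :
    exchange 𝕜 u v (X (Sum.inl p) ^ a) = X (Sum.inl p) ^ a := by
  rw [map_pow, exchange_inl, Equiv.swap_apply_of_ne_of_ne hu hv]

theorem exchange_X_pow_inr {u v p : ι} (hu : p ≠ u) (hv : p ≠ v) (a : ℕ) :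
    exchange 𝕜 u v (X (Sum.inr p) ^ a) = X (Sum.inr p) ^ a := by
  rw [map_pow, exchange_inr, Equiv.swap_apply_of_ne_of_ne hu hv]

variable [CharZero 𝕜]

theorem eq_zero_of_eq_neg_self {a : 𝕜} (h : a = -a) : a = 0 := self_eq_neg.1 h

/-- A functional that is antisymmetric under the exchange of `u` and `v` and kills the multiples of
the variables at `u` and `v` is zero. -/
theorem linearMap_eq_zero_of_exchange (φ : MvPolynomial (ι ⊕ ι) 𝕜 →ₗ[𝕜] 𝕜) (u v : ι)
    (has : ∀ F, φ (exchange 𝕜 u v F) = -φ F)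
    (hxu : ∀ F, φ (X (Sum.inl u) * F) = 0) (hxv : ∀ F, φ (X (Sum.inl v) * F) = 0)
    (hyu : ∀ F, φ (X (Sum.inr u) * F) = 0) (hyv : ∀ F, φ (X (Sum.inr v) * F) = 0)
    (F : MvPolynomial (ι ⊕ ι) 𝕜) : φ F = 0 := by
  -- Variables at other places are absorbed into an invariant factor G; at constants, antisymmetry
  -- gives zero.
  suffices H : ∀ G, exchange 𝕜 u v G = G → φ (G * F) = 0 by simpa using H 1 (map_one _)
  induction F using MvPolynomial.induction_on with
  | C a =>
    intro G hG
    refine eq_zero_of_eq_neg_self ?_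
    rw [← has, map_mul (exchange 𝕜 u v), hG]
    congr 2
    simp [exchange]
  | add F₁ F₂ h₁ h₂ => intro G hG; rw [mul_add, map_add, h₁ G hG, h₂ G hG, add_zero]
  | mul_X F n ih =>
    intro G hG
    by_cases hn : n = Sum.inl u ∨ n = Sum.inl v ∨ n = Sum.inr u ∨ n = Sum.inr v
    · rw [← mul_assoc, mul_comm]
      rcases hn with rfl | rfl | rfl | rfl
      exacts [hxu _, hxv _, hyu _, hyv _]
    · rw [mul_comm F, ← mul_assoc]
      refine ih _ ?_
      rw [map_mul, hG]
      congr 1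
      push Not at hn
      rcases n with p | p
      · rw [exchange_inl, Equiv.swap_apply_of_ne_of_ne (by aesop) (by aesop)]
      · rw [exchange_inr, Equiv.swap_apply_of_ne_of_ne (by aesop) (by aesop)]

/-- If `Λ` kills the multiples of `x_q ^ (M + 1)` and is antisymmetric, then it kills the complete
symmetric polynomials of large degree. -/
theorem completeX_kill {Λ : MvPolynomial (ι ⊕ ι) 𝕜 →ₗ[𝕜] 𝕜} {R : Finset ι} {M : ℕ}
    (hx : ∀ q ∈ R, ∀ F, Λ (X (Sum.inl q) ^ (M + 1) * F) = 0)
    (has : ∀ u ∈ R, ∀ v ∈ R, u ≠ v → ∀ F, Λ (exchange 𝕜 u v F) = -Λ F) (n : ℕ) :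
    ∀ P : Finset ι, P.card = n + 1 → P ⊆ R → ∀ t, M + 2 ≤ t + (n + 1) → ∀ (a : ι → ℕ) F,
      (∀ u ∈ P, ∀ v ∈ P, exchange 𝕜 u v F = F) →
      Λ (completeX 𝕜 P t * ((∏ p ∈ P, X (Sum.inl p) ^ a p) * F)) = 0 := by
  induction n with
  | zero =>
    intro P hP hPR t ht a F _
    obtain ⟨p, rfl⟩ := Finset.card_eq_one.1 hP
    obtain ⟨s, rfl⟩ := Nat.exists_eq_add_of_le (show M + 1 ≤ t by omega)
    rw [completeX_singleton, pow_add, mul_assoc]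
    exact hx p (hPR (Finset.mem_singleton_self p)) _
  | succ n ih =>
    intro P hP hPR t ht a F hF
    obtain ⟨u, P₁, hu, rfl, hP₁⟩ := Finset.card_eq_succ.1 hP
    obtain ⟨v, P₂, hv, rfl, hP₂⟩ := Finset.card_eq_succ.1 hP₁
    simp only [Finset.mem_insert, not_or] at hu
    obtain ⟨huv, hu⟩ := hu
    -- The induction hypothesis with z removed from P; the power of x_z moves into the symmetric
    -- factor.
    have hP₃ (w z : ι) (hw : w ∉ P₂) (hz : z ∉ P₂) (hwz : w ≠ z)
        (hwP : insert w P₂ ⊆ insert u (insert v P₂)) (i j : ℕ) :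
        Λ (completeX 𝕜 (insert w P₂) (t + 1) *
          (X (Sum.inl w) ^ i * (∏ p ∈ P₂, X (Sum.inl p) ^ a p) * (X (Sum.inl z) ^ j * F))) = 0 := by
      have hne {r : ι} (hr : r ∈ insert w P₂) : z ≠ r := by
        rintro rfl
        exact (Finset.mem_insert.1 hr).elim (fun h => hwz h.symm) hz
      have := ih (insert w P₂) (by rw [Finset.card_insert_of_notMem hw, hP₂]) (hwP.trans hPR)
        (t + 1) (by omega) (Function.update a w i) (X (Sum.inl z) ^ j * F) (fun r hr s hs => by
          rw [map_mul, hF r (hwP hr) s (hwP hs), exchange_X_pow_inl (hne hr) (hne hs)])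
      have hprod : ∏ p ∈ P₂, (X (Sum.inl p) : MvPolynomial (ι ⊕ ι) 𝕜) ^ Function.update a w i p =
          ∏ p ∈ P₂, X (Sum.inl p) ^ a p :=
        Finset.prod_congr rfl fun p hp => by
          rw [Function.update_of_ne (ne_of_mem_of_not_mem hp hw)]
      rwa [Finset.prod_insert hw, Function.update_self, hprod] at this
    set Φ : ℕ → ℕ → 𝕜 := fun i j => Λ (completeX 𝕜 (insert u (insert v P₂)) t *
      (X (Sum.inl u) ^ i * X (Sum.inl v) ^ j * (∏ p ∈ P₂, X (Sum.inl p) ^ a p) * F)) with hΦ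
    -- The difference contains (x_u - x_v) h_t, which is a difference of two h_(t+1) in fewer
    -- variables, both killed by `hP₃`.
    have hshift (i j : ℕ) : Φ (i + 1) j = Φ i (j + 1) := by
      rw [← sub_eq_zero, hΦ]
      have h1 := hP₃ u v hu hv huv
        (Finset.insert_subset_insert _ (Finset.subset_insert _ _)) i j
      have h2 := hP₃ v u hv hu (Ne.symm huv) (Finset.subset_insert _ _) j i
      have h3 := sub_mul_completeX (𝕜 := 𝕜) huv hu hv t
      rw [← sub_zero (0 : 𝕜)]
      nth_rewrite 1 [← h1]
      rw [← h2, ← map_sub, ← map_sub]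
      congr 1
      linear_combination (X (Sum.inl u) ^ i * X (Sum.inl v) ^ j *
        (∏ p ∈ P₂, X (Sum.inl p) ^ a p) * F) * h3
    have hsymm (i j : ℕ) : Φ i j = Φ 0 (i + j) := by
      induction i generalizing j with
      | zero => rw [zero_add]
      | succ i ihi => rw [hshift, ihi]; congr 1; omega
    have hanti (i j : ℕ) : Φ j i = -Φ i j := by
      rw [hΦ]
      simp only
      rw [← has u (hPR (by simp)) v (hPR (by simp)) huv]
      congr 1
      rw [map_mul, map_mul, map_mul, map_mul, hF u (by simp) v (by simp),
        exchange_completeX u v _ (by simp), map_pow, map_pow, exchange_inl, exchange_inl,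
        Equiv.swap_apply_left, Equiv.swap_apply_right, map_prod]
      rw [Finset.prod_congr rfl fun p hp => exchange_X_pow_inl (𝕜 := 𝕜) (u := u) (v := v)
        (fun h => hu (h ▸ hp)) (fun h => hv (h ▸ hp)) (a p)]
      ring
    -- Φ depends only on i + j, yet changes sign when i and j are swapped.
    have h0 : Φ (a u) (a v) = 0 := by
      refine eq_zero_of_eq_neg_self ?_
      rw [← hanti, hsymm, hsymm (a v), add_comm]
    rw [Finset.prod_insert (by simp [huv, hu]), Finset.prod_insert hv, ← mul_assoc (_ ^ _)]
    exact h0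

end Functionals

/-! ### Hook functionals: removing a cell by a top power. -/

section AntisymmetricFunctional

variable {ι 𝕜 : Type*} [Field 𝕜] [DecidableEq ι]

/-- The functional `F ↦ Λ (G * F)`. -/
noncomputable def mulFunctional (G : MvPolynomial (ι ⊕ ι) 𝕜)
    (Λ : MvPolynomial (ι ⊕ ι) 𝕜 →ₗ[𝕜] 𝕜) : MvPolynomial (ι ⊕ ι) 𝕜 →ₗ[𝕜] 𝕜 :=
  Λ ∘ₗ LinearMap.mulLeft 𝕜 G

omit [DecidableEq ι] in
theorem mulFunctional_apply (G F : MvPolynomial (ι ⊕ ι) 𝕜)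
    (Λ : MvPolynomial (ι ⊕ ι) 𝕜 →ₗ[𝕜] 𝕜) : mulFunctional G Λ F = Λ (G * F) := rfl

/-- `Λ` behaves like the pairing with the determinant of the hook `(k + 1, 1 ^ l)` in the variables
with places in `R ∪ Z`, where exactly one of the places of `Z` is excluded from the determinant
and the other places of `Z` carry powers of `y`. -/
structure HookFunctional (R Z : Finset ι) (k l : ℕ)
    (Λ : MvPolynomial (ι ⊕ ι) 𝕜 →ₗ[𝕜] 𝕜) : Prop where
  disjoint : Disjoint R Z
  x_pow : ∀ q ∈ R, ∀ F, Λ (X (Sum.inl q) ^ (l + 1) * F) = 0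
  y_pow : ∀ q ∈ R ∪ Z, ∀ F, Λ (X (Sum.inr q) ^ (k + 1) * F) = 0
  x_mul_y : ∀ q ∈ R, ∀ F, Λ (X (Sum.inl q) * (X (Sum.inr q) * F)) = 0
  x_pending : ∀ q ∈ Z, ∀ F, Λ (X (Sum.inl q) * F) = 0
  anti : ∀ u ∈ R, ∀ v ∈ R, u ≠ v → ∀ F, Λ (exchange 𝕜 u v F) = -Λ F
  anti_y : ∀ u ∈ R ∪ Z, ∀ v ∈ R ∪ Z, u ≠ v → ∀ F,
    Λ (X (Sum.inr u) * (X (Sum.inr v) * exchange 𝕜 u v F)) =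
      -Λ (X (Sum.inr u) * (X (Sum.inr v) * F))
  y_pending : Z.Nonempty → ∀ F, Λ ((∏ q ∈ Z, X (Sum.inr q)) * F) = 0
  arrangement : ∀ E ⊆ Z, (Z.Nonempty → E.card = 1) → ∀ v : ι → ℕ × ℕ,
    Set.InjOn v ((R ∪ Z) \ E : Finset ι) →
    (∀ p ∈ (R ∪ Z) \ E, (v p).1 ≤ l ∧ (v p).2 ≤ k ∧ ((v p).1 = 0 ∨ (v p).2 = 0)) →
    (∀ p ∈ Z \ E, 0 < (v p).2) → Λ (∏ p ∈ (R ∪ Z) \ E, token 𝕜 p (v p)) ≠ 0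

namespace HookFunctional

variable {R Z : Finset ι} {k l : ℕ} {Λ : MvPolynomial (ι ⊕ ι) 𝕜 →ₗ[𝕜] 𝕜}

theorem x_mul_y' (h : HookFunctional R Z k l Λ) {q : ι} (hq : q ∈ R ∪ Z)
    (F : MvPolynomial (ι ⊕ ι) 𝕜) : Λ (X (Sum.inl q) * (X (Sum.inr q) * F)) = 0 := by
  rcases Finset.mem_union.1 hq with hq | hq
  · exact h.x_mul_y q hq F
  · exact h.x_pending q hq _

theorem x_pow_mul_y (h : HookFunctional R Z k l Λ) {q : ι} (hq : q ∈ R ∪ Z) {a b : ℕ}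
    (ha : a ≠ 0) (hb : b ≠ 0) (F : MvPolynomial (ι ⊕ ι) 𝕜) :
    Λ (X (Sum.inl q) ^ a * (X (Sum.inr q) ^ b * F)) = 0 := by
  obtain ⟨a, rfl⟩ := Nat.exists_eq_succ_of_ne_zero ha
  obtain ⟨b, rfl⟩ := Nat.exists_eq_succ_of_ne_zero hb
  rw [← h.x_mul_y' hq (X (Sum.inl q) ^ a * (X (Sum.inr q) ^ b * F))]
  congr 1
  rw [pow_succ, pow_succ]
  ring

theorem x_pow_of_lt (h : HookFunctional R Z k l Λ) {q : ι} (hq : q ∈ R) {a : ℕ}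
    (ha : l < a) (F : MvPolynomial (ι ⊕ ι) 𝕜) : Λ (X (Sum.inl q) ^ a * F) = 0 := by
  obtain ⟨a, rfl⟩ := Nat.exists_eq_add_of_le (Nat.succ_le_of_lt ha)
  rw [pow_add, mul_assoc]
  exact h.x_pow q hq _

theorem y_pow_of_lt (h : HookFunctional R Z k l Λ) {q : ι} (hq : q ∈ R ∪ Z) {a : ℕ}
    (ha : k < a) (F : MvPolynomial (ι ⊕ ι) 𝕜) : Λ (X (Sum.inr q) ^ a * F) = 0 := by
  obtain ⟨a, rfl⟩ := Nat.exists_eq_add_of_le (Nat.succ_le_of_lt ha)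
  rw [pow_add, mul_assoc]
  exact h.y_pow q hq _

/-- A single pending place must be the excluded one, so it can be dropped. -/
theorem close {j : ι} (h : HookFunctional R {j} k l Λ) : HookFunctional R ∅ k l Λ where
  disjoint := Finset.disjoint_empty_right _
  x_pow := h.x_pow
  y_pow q hq := h.y_pow q (by simp at hq; simp [hq])
  x_mul_y := h.x_mul_y
  x_pending := by simp
  anti := h.anti
  anti_y u hu v hv := h.anti_y u (by simp at hu; simp [hu]) v (by simp at hv; simp [hv])
  y_pending := by simp
  arrangement := by
    intro E hE _ v hinj hv _
    obtain rfl := Finset.subset_empty.1 hE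
    have hR : (R ∪ {j}) \ {j} = (R ∪ ∅) \ ∅ := by
      rw [Finset.union_empty, Finset.sdiff_empty, Finset.union_sdiff_right,
        Finset.sdiff_eq_self_of_disjoint h.disjoint]
    have := h.arrangement {j} subset_rfl (fun _ => Finset.card_singleton _) v
    rw [hR] at this
    exact this hinj hv (by simp)

variable [CharZero 𝕜]

/-- Beside the two top powers any further variable at p or q dies, by degree or as a mixed product.
What survives is fixed by the exchange, while the functional changes sign. -/
theorem x_clash (h : HookFunctional R Z k (l + 1) Λ) {p q : ι} (hp : p ∈ R) (hq : q ∈ R)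
    (hpq : p ≠ q) (F : MvPolynomial (ι ⊕ ι) 𝕜) :
    Λ (X (Sum.inl p) ^ (l + 1) * (X (Sum.inl q) ^ (l + 1) * F)) = 0 := by
  refine linearMap_eq_zero_of_exchange
    (mulFunctional (X (Sum.inl p) ^ (l + 1)) (mulFunctional (X (Sum.inl q) ^ (l + 1)) Λ) :
      MvPolynomial (ι ⊕ ι) 𝕜 →ₗ[𝕜] 𝕜) p q ?_ ?_ ?_ ?_ ?_ F |> Eq.trans ?_
  · simp only [mulFunctional_apply]
    congr 1; ring
  · intro F
    simp only [mulFunctional_apply]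
    rw [← h.anti p hp q hq hpq]
    congr 1
    simp only [map_mul, map_pow, exchange_inl, Equiv.swap_apply_left, Equiv.swap_apply_right]
    ring
  · intro F
    simp only [mulFunctional_apply]
    rw [← h.x_pow p hp (X (Sum.inl q) ^ (l + 1) * F)]
    congr 1; ring
  · intro F
    simp only [mulFunctional_apply]
    rw [← h.x_pow q hq (X (Sum.inl p) ^ (l + 1) * F)]
    congr 1; ring
  · intro F
    simp only [mulFunctional_apply]
    rw [← h.x_mul_y p hp (X (Sum.inl p) ^ l * (X (Sum.inl q) ^ (l + 1) * F))]
    congr 1; ring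
  · intro F
    simp only [mulFunctional_apply]
    rw [← h.x_mul_y q hq (X (Sum.inl q) ^ l * (X (Sum.inl p) ^ (l + 1) * F))]
    congr 1; ring

/-- As for x, but pending places break plain antisymmetry: the sign comes from `anti_y`, after y_p
y_q is split off the powers. -/
theorem y_clash (h : HookFunctional R Z (k + 1) l Λ) {p q : ι} (hp : p ∈ R ∪ Z) (hq : q ∈ R ∪ Z)
    (hpq : p ≠ q) (F : MvPolynomial (ι ⊕ ι) 𝕜) :
    Λ (X (Sum.inr p) ^ (k + 1) * (X (Sum.inr q) ^ (k + 1) * F)) = 0 := by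
  refine linearMap_eq_zero_of_exchange
    (mulFunctional (X (Sum.inr p) ^ (k + 1)) (mulFunctional (X (Sum.inr q) ^ (k + 1)) Λ) :
      MvPolynomial (ι ⊕ ι) 𝕜 →ₗ[𝕜] 𝕜) p q ?_ ?_ ?_ ?_ ?_ F |> Eq.trans ?_
  · simp only [mulFunctional_apply]
    congr 1; ring
  · intro F
    simp only [mulFunctional_apply]
    have := h.anti_y p hp q hq hpq (X (Sum.inr p) ^ k * (X (Sum.inr q) ^ k * F))
    simp only [map_mul, map_pow, exchange_inr, Equiv.swap_apply_left,
      Equiv.swap_apply_right] at this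
    convert this using 2
    · ring
    · congr 1; ring
  · intro F
    simp only [mulFunctional_apply]
    rw [← h.x_mul_y' hp (X (Sum.inr p) ^ k * (X (Sum.inr q) ^ (k + 1) * F))]
    congr 1; ring
  · intro F
    simp only [mulFunctional_apply]
    rw [← h.x_mul_y' hq (X (Sum.inr q) ^ k * (X (Sum.inr p) ^ (k + 1) * F))]
    congr 1; ring
  · intro F
    simp only [mulFunctional_apply]
    rw [← h.y_pow p hp (X (Sum.inr q) ^ (k + 1) * F)]
    congr 1; ring
  · intro F
    simp only [mulFunctional_apply]
    rw [← h.y_pow q hq (X (Sum.inr p) ^ (k + 1) * F)]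
    congr 1; ring

theorem mul_x (h : HookFunctional R Z k (l + 1) Λ) {p : ι} (hp : p ∈ R) :
    HookFunctional (R.erase p) Z k l (mulFunctional (X (Sum.inl p) ^ (l + 1)) Λ) where
  disjoint := h.disjoint.mono_left (Finset.erase_subset _ _)
  x_pow q hq F := h.x_clash hp (Finset.mem_of_mem_erase hq) (Finset.ne_of_mem_erase hq).symm F
  y_pow q hq F := by
    rw [mulFunctional_apply, mul_left_comm]
    exact h.y_pow q (Finset.union_subset_union_left (Finset.erase_subset _ _) hq) _
  x_mul_y q hq F := by
    rw [mulFunctional_apply, mul_left_comm, mul_left_comm (X (Sum.inl p) ^ (l + 1))]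
    exact h.x_mul_y q (Finset.mem_of_mem_erase hq) _
  x_pending q hq F := by
    rw [mulFunctional_apply, mul_left_comm]
    exact h.x_pending q hq _
  anti u hu v hv huv F := by
    simp only [mulFunctional_apply]
    rw [← h.anti u (Finset.mem_of_mem_erase hu) v (Finset.mem_of_mem_erase hv) huv, map_mul (exchange 𝕜 u v),
      exchange_X_pow_inl (Finset.ne_of_mem_erase hu).symm (Finset.ne_of_mem_erase hv).symm]
  anti_y u hu v hv huv F := by
    have hne {w : ι} (hw : w ∈ R.erase p ∪ Z) : p ≠ w := by
      rintro rfl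
      rcases Finset.mem_union.1 hw with hw | hw
      · exact Finset.notMem_erase _ _ hw
      · exact Finset.disjoint_left.1 h.disjoint hp hw
    have hsub := Finset.union_subset_union_left (t := Z) (Finset.erase_subset p R)
    have := h.anti_y u (hsub hu) v (hsub hv) huv (X (Sum.inl p) ^ (l + 1) * F)
    rw [map_mul (exchange 𝕜 u v), exchange_X_pow_inl (hne hu) (hne hv)] at this
    simp only [mulFunctional_apply]
    convert this using 2
    · ring
    · congr 1; ring
  y_pending hZ F := by
    rw [mulFunctional_apply, mul_left_comm]
    exact h.y_pending hZ _
  arrangement E hE hE1 v hinj hv hZ := by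
    have hpZ : p ∉ Z := Finset.disjoint_left.1 h.disjoint hp
    have hset : (R ∪ Z) \ E = insert p ((R.erase p ∪ Z) \ E) := by
      rw [← Finset.insert_sdiff_of_notMem _ (fun hpE => hpZ (hE hpE)), ← Finset.insert_union,
        Finset.insert_erase hp]
    have hnot : p ∉ (R.erase p ∪ Z) \ E := by simp [hpZ]
    have hval : ∀ q ∈ (R.erase p ∪ Z) \ E, Function.update v p (l + 1, 0) q = v q := fun q hq =>
      Function.update_of_ne (ne_of_mem_of_not_mem hq hnot) _ _
    -- The end cell (l + 1, 0) of the leg goes to p; no remaining place can use it.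
    have := h.arrangement E hE hE1 (Function.update v p (l + 1, 0)) ?_ ?_ ?_
    · rw [hset, Finset.prod_insert hnot, Function.update_self,
        Finset.prod_congr rfl fun q hq => by rw [hval q hq]] at this
      simpa [mulFunctional_apply, token] using this
    · rw [hset, Finset.coe_insert, Set.injOn_insert (by exact_mod_cast hnot)]
      refine ⟨hinj.congr fun q hq => (hval q hq).symm, ?_⟩
      rintro ⟨q, hq, hqv⟩
      rw [hval q hq, Function.update_self] at hqv
      have := (hv q hq).1
      rw [hqv] at this
      simp at this
    · intro q hq
      rw [hset, Finset.mem_insert] at hq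
      rcases hq with rfl | hq
      · simp
      · rw [hval q hq]
        obtain ⟨h1, h2, h3⟩ := hv q hq
        exact ⟨by omega, h2, h3⟩
    · intro q hq
      rw [Function.update_of_ne]
      · exact hZ q hq
      · rintro rfl
        exact hpZ (Finset.mem_sdiff.1 hq).1

/-- If p were the only pending place, `y_pending` would make the new functional zero; hence `Z ≠
{p}`. -/
theorem mul_y (h : HookFunctional R Z (k + 1) l Λ) {p : ι} (hp : p ∈ R ∪ Z) (hZp : Z ≠ {p}) :
    HookFunctional (R.erase p) (Z.erase p) k l (mulFunctional (X (Sum.inr p) ^ (k + 1)) Λ) := by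
  have hU : R.erase p ∪ Z.erase p = (R ∪ Z).erase p := (Finset.erase_union_distrib _ _ _).symm
  have hne {w : ι} (hw : w ∈ (R ∪ Z).erase p) : p ≠ w := (Finset.ne_of_mem_erase hw).symm
  have hmem {w : ι} (hw : w ∈ (R ∪ Z).erase p) : w ∈ R ∪ Z := Finset.mem_of_mem_erase hw
  constructor
  case disjoint => exact h.disjoint.mono (Finset.erase_subset _ _) (Finset.erase_subset _ _)
  case x_pow =>
    intro q hq F
    rw [mulFunctional_apply, mul_left_comm]
    exact h.x_pow q (Finset.mem_of_mem_erase hq) _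
  case y_pow =>
    intro q hq F
    rw [hU] at hq
    exact h.y_clash hp (hmem hq) (hne hq) F
  case x_mul_y =>
    intro q hq F
    rw [mulFunctional_apply, mul_left_comm, mul_left_comm (X (Sum.inr p) ^ (k + 1))]
    exact h.x_mul_y q (Finset.mem_of_mem_erase hq) _
  case x_pending =>
    intro q hq F
    rw [mulFunctional_apply, mul_left_comm]
    exact h.x_pending q (Finset.mem_of_mem_erase hq) _
  case anti =>
    intro u hu v hv huv F
    simp only [mulFunctional_apply]
    rw [← h.anti u (Finset.mem_of_mem_erase hu) v (Finset.mem_of_mem_erase hv) huv, map_mul (exchange 𝕜 u v),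
      exchange_X_pow_inr (Finset.ne_of_mem_erase hu).symm (Finset.ne_of_mem_erase hv).symm]
  case anti_y =>
    intro u hu v hv huv F
    rw [hU] at hu hv
    have := h.anti_y u (hmem hu) v (hmem hv) huv (X (Sum.inr p) ^ (k + 1) * F)
    rw [map_mul (exchange 𝕜 u v), exchange_X_pow_inr (hne hu) (hne hv)] at this
    simp only [mulFunctional_apply]
    convert this using 2
    · ring
    · congr 1; ring
  case y_pending =>
    intro hZ F
    rw [mulFunctional_apply]
    by_cases hpZ : p ∈ Z
    · rw [← h.y_pending ⟨p, hpZ⟩ (X (Sum.inr p) ^ k * F), ← Finset.mul_prod_erase Z _ hpZ]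
      congr 1; ring
    · rw [Finset.erase_eq_of_notMem hpZ] at hZ ⊢
      rw [mul_left_comm]
      exact h.y_pending hZ _
  case arrangement =>
    intro E hE hE1 v hinj hv hZ
    have hpE : p ∉ E := fun hpE => Finset.notMem_erase p Z (hE hpE)
    have hset : (R ∪ Z) \ E = insert p ((R.erase p ∪ Z.erase p) \ E) := by
      rw [hU, ← Finset.insert_sdiff_of_notMem _ hpE, Finset.insert_erase hp]
    have hnot : p ∉ (R.erase p ∪ Z.erase p) \ E := by simp
    have hval : ∀ q ∈ (R.erase p ∪ Z.erase p) \ E, Function.update v p (0, k + 1) q = v q :=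
      fun q hq => Function.update_of_ne (ne_of_mem_of_not_mem hq hnot) _ _
    have := h.arrangement E (hE.trans (Finset.erase_subset _ _)) ?_
      (Function.update v p (0, k + 1)) ?_ ?_ ?_
    · rw [hset, Finset.prod_insert hnot, Function.update_self,
        Finset.prod_congr rfl fun q hq => by rw [hval q hq]] at this
      simpa [mulFunctional_apply, token] using this
    · intro hZn
      refine hE1 ?_
      by_contra hempty
      rw [Finset.not_nonempty_iff_eq_empty, Finset.erase_eq_empty_iff] at hempty
      exact hempty.elim (fun h0 => hZn.ne_empty h0) hZp
    · rw [hset, Finset.coe_insert, Set.injOn_insert (by exact_mod_cast hnot)]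
      refine ⟨hinj.congr fun q hq => (hval q hq).symm, ?_⟩
      rintro ⟨q, hq, hqv⟩
      rw [hval q hq, Function.update_self] at hqv
      have := (hv q hq).2.1
      rw [hqv] at this
      simp at this
    · intro q hq
      rw [hset, Finset.mem_insert] at hq
      rcases hq with rfl | hq
      · simp
      · rw [hval q hq]
        obtain ⟨h1, h2, h3⟩ := hv q hq
        exact ⟨h1, by omega, h3⟩
    · intro q hq
      by_cases hqp : q = p
      · subst hqp; simp
      · rw [Function.update_of_ne hqp]
        refine hZ q ?_
        rw [Finset.mem_sdiff] at hq ⊢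
        exact ⟨Finset.mem_erase.2 ⟨hqp, hq.1⟩, hq.2⟩

end HookFunctional

end AntisymmetricFunctional

/-! ### Hook functionals: multiplication by a complete symmetric polynomial. -/

section AntisymmetricFunctional

variable {ι 𝕜 : Type*} [Field 𝕜] [DecidableEq ι]

namespace HookFunctional

variable {R Z : Finset ι} {k l : ℕ} {Λ : MvPolynomial (ι ⊕ ι) 𝕜 →ₗ[𝕜] 𝕜}

/-- The terms of h_(t+1) containing x_u die against y_u. -/
theorem completeX_erase (h : HookFunctional R Z k l Λ) {P : Finset ι} (hP : P ⊆ R ∪ Z) (t : ℕ)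
    (u : ι) (F : MvPolynomial (ι ⊕ ι) 𝕜) :
    Λ (completeX 𝕜 P (t + 1) * (X (Sum.inr u) * F)) =
      Λ (completeX 𝕜 (P.erase u) (t + 1) * (X (Sum.inr u) * F)) := by
  by_cases hu : u ∈ P
  · conv_lhs => rw [← Finset.insert_erase hu]
    rw [completeX_insert (Finset.notMem_erase u P), Finset.insert_erase hu, add_mul, map_add,
      add_eq_left, ← h.x_mul_y' (hP hu) (completeX 𝕜 P t * F)]
    congr 1; ring
  · rw [Finset.erase_eq_of_notMem hu]

theorem completeX_sdiff (h : HookFunctional R Z k l Λ) (Q : Finset ι) :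
    ∀ {P : Finset ι}, P ⊆ R ∪ Z → ∀ (t : ℕ) (F : MvPolynomial (ι ⊕ ι) 𝕜),
    Λ (completeX 𝕜 P (t + 1) * ((∏ q ∈ Q, X (Sum.inr q)) * F)) =
      Λ (completeX 𝕜 (P \ Q) (t + 1) * ((∏ q ∈ Q, X (Sum.inr q)) * F)) := by
  induction Q using Finset.induction_on with
  | empty => intro P _ t F; rw [Finset.sdiff_empty]
  | insert q Q hq ih =>
    intro P hP t F
    rw [Finset.prod_insert hq, mul_assoc, h.completeX_erase hP, mul_left_comm (X (Sum.inr q)),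
      ih ((Finset.erase_subset _ _).trans hP), Finset.sdiff_insert, Finset.erase_sdiff_comm]

/-- The `y`-variables at the places of `P` that occur in a monomial remove these places from a
complete symmetric polynomial. -/
theorem completeX_tokens [Fintype ι] (h : HookFunctional R Z k l Λ) {P : Finset ι}
    (hP : P ⊆ R ∪ Z) (t : ℕ) (v : ι → ℕ × ℕ) :
    Λ (completeX 𝕜 P (t + 1) * ∏ p, token 𝕜 p (v p)) =
      Λ (completeX 𝕜 (P.filter fun p => (v p).2 = 0) (t + 1) *
        ((∏ p ∈ P.filter fun p => (v p).2 = 0, X (Sum.inl p) ^ (v p).1) *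
          ∏ p ∈ (P.filter fun p => (v p).2 = 0)ᶜ, token 𝕜 p (v p))) := by
  set Q := P.filter fun p => (v p).2 ≠ 0
  have hPQ : P \ Q = P.filter fun p => (v p).2 = 0 := by
    ext p
    simp only [Q, Finset.mem_sdiff, Finset.mem_filter]
    tauto
  have hdvd : (∏ q ∈ Q, (X (Sum.inr q) : MvPolynomial (ι ⊕ ι) 𝕜)) ∣
      ∏ p, token 𝕜 p (v p) :=
    (Finset.prod_dvd_prod_of_dvd _ (fun p => token 𝕜 p (v p)) fun q hq =>
      (dvd_pow_self _ (Finset.mem_filter.1 hq).2).mul_left _).trans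
      (Finset.prod_dvd_prod_of_subset _ _ _ (Finset.subset_univ _))
  have hsplit : ∏ p, token 𝕜 p (v p) =
      (∏ p ∈ P.filter fun p => (v p).2 = 0, X (Sum.inl p) ^ (v p).1) *
          ∏ p ∈ (P.filter fun p => (v p).2 = 0)ᶜ, token 𝕜 p (v p) := by
    rw [← Finset.prod_mul_prod_compl (P.filter fun p => (v p).2 = 0) fun p => token 𝕜 p (v p)]
    congr 1
    refine Finset.prod_congr rfl fun p hp => ?_
    rw [token, (Finset.mem_filter.1 hp).2, pow_zero, mul_one]
  rw [← hsplit]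
  obtain ⟨F, hF⟩ := hdvd
  rw [hF, h.completeX_sdiff Q hP, hPQ]

theorem exchange_prod_compl [Fintype ι] {P : Finset ι} {u v : ι} (hu : u ∈ P) (hv : v ∈ P)
    (w : ι → ℕ × ℕ) :
    exchange 𝕜 u v (∏ p ∈ Pᶜ, token 𝕜 p (w p)) = ∏ p ∈ Pᶜ, token 𝕜 p (w p) := by
  rw [map_prod]
  refine Finset.prod_congr rfl fun p hp => exchange_token_of_ne ?_ ?_ _
  · rintro rfl; exact Finset.mem_compl.1 hp hu
  · rintro rfl; exact Finset.mem_compl.1 hp hv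

variable [CharZero 𝕜] [Fintype ι]

/-- On a monomial, the places carrying y drop out of h_(l+1). If none is left, h_(l+1) is zero;
otherwise `completeX_kill` applies, even with a single variable. -/
theorem completeX_eq_zero (h : HookFunctional R ∅ k l Λ) {P : Finset ι} (hP : P ⊆ R)
    (F : MvPolynomial (ι ⊕ ι) 𝕜) : Λ (completeX 𝕜 P (l + 1) * F) = 0 := by
  refine linearMap_eq_zero_of_tokens (mulFunctional (completeX 𝕜 P (l + 1)) Λ) (fun v => ?_) F
  rw [mulFunctional_apply, h.completeX_tokens (by simpa using hP)]
  set P' := P.filter fun p => (v p).2 = 0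
  rcases Nat.eq_zero_or_eq_succ_pred P'.card with h0 | h0
  · rw [Finset.card_eq_zero.1 h0, completeX_empty (Nat.succ_ne_zero _), zero_mul, map_zero]
  · exact completeX_kill h.x_pow h.anti _ P' h0 ((Finset.filter_subset _ _).trans hP) _ (by omega)
      _ _ (fun a ha b hb => exchange_prod_compl ha hb v)

/-- The degree is one short of the killing exponent l + 2, so `completeX_kill` needs two places
without y. If g alone is left, the factor x_g supplies the missing degree; if g carries y, x_g y_g
dies. -/
theorem completeX_mul_x_eq_zero (h : HookFunctional R ∅ k (l + 1) Λ) {P : Finset ι} (hP : P ⊆ R)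
    {g : ι} (hg : g ∈ P) (F : MvPolynomial (ι ⊕ ι) 𝕜) :
    Λ (completeX 𝕜 P (l + 1) * (X (Sum.inl g) * F)) = 0 := by
  refine linearMap_eq_zero_of_tokens
    (mulFunctional (X (Sum.inl g)) (mulFunctional (completeX 𝕜 P (l + 1)) Λ)) (fun v => ?_) F
  rw [mulFunctional_apply, mulFunctional_apply]
  by_cases hvg : (v g).2 = 0
  · set v' : ι → ℕ × ℕ := Function.update v g ((v g).1 + 1, (v g).2) with hv'
    have htok : X (Sum.inl g) * ∏ p, token 𝕜 p (v p) = ∏ p, token 𝕜 p (v' p) := by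
      rw [← Finset.mul_prod_erase _ _ (Finset.mem_univ g),
        ← Finset.mul_prod_erase _ (fun p => token 𝕜 p (v' p)) (Finset.mem_univ g), ← mul_assoc]
      congr 1
      · rw [hv', Function.update_self, token, token, pow_succ]
        ring
      · refine Finset.prod_congr rfl fun p hp => ?_
        rw [hv', Function.update_of_ne (Finset.ne_of_mem_erase hp)]
    rw [htok, h.completeX_tokens (by simpa using hP)]
    have hgv' : v' g = ((v g).1 + 1, 0) := by rw [hv', Function.update_self, hvg]
    set P' := P.filter fun p => (v' p).2 = 0 with hP'
    have hgP' : g ∈ P' := Finset.mem_filter.2 ⟨hg, by rw [hgv']⟩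
    have hP'R : P' ⊆ R := (Finset.filter_subset _ _).trans hP
    by_cases h1 : P'.card = 1
    · obtain ⟨a, ha⟩ := Finset.card_eq_one.1 h1
      rw [ha, Finset.mem_singleton] at hgP'
      subst hgP'
      rw [ha, completeX_singleton, Finset.prod_singleton, hgv', ← mul_assoc, ← pow_add]
      exact h.x_pow_of_lt (hP hg) (by omega) _
    · have h2 : 0 < P'.card := Finset.card_pos.2 ⟨g, hgP'⟩
      exact completeX_kill h.x_pow h.anti (P'.card - 1) P' (by omega) hP'R _ (by omega)
        _ _ (fun a ha b hb => exchange_prod_compl ha hb v')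
  · rw [← Finset.mul_prod_erase _ _ (Finset.mem_univ g), token]
    obtain ⟨b, hb⟩ := Nat.exists_eq_succ_of_ne_zero hvg
    rw [hb, ← h.x_mul_y g (hP hg) (completeX 𝕜 P (l + 1) * (X (Sum.inl g) ^ (v g).1 *
      X (Sum.inr g) ^ b * ∏ p ∈ Finset.univ.erase g, token 𝕜 p (v p)))]
    congr 1
    rw [pow_succ]
    ring

omit [CharZero 𝕜] [Fintype ι] in
-- The polynomial is not symmetric in u, v if G contains just one of them, but y_u y_v deletes both
-- places from it.
theorem completeX_anti_y (h : HookFunctional R ∅ k l Λ) {G : Finset ι} (hG : G ⊆ R) {u v : ι}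
    (hu : u ∈ R) (hv : v ∈ R) (huv : u ≠ v) {t : ℕ} (F : MvPolynomial (ι ⊕ ι) 𝕜) :
    mulFunctional (completeX 𝕜 G (t + 1)) Λ
        (X (Sum.inr u) * (X (Sum.inr v) * exchange 𝕜 u v F)) =
      -mulFunctional (completeX 𝕜 G (t + 1)) Λ (X (Sum.inr u) * (X (Sum.inr v) * F)) := by
  have hred (F : MvPolynomial (ι ⊕ ι) 𝕜) :
      mulFunctional (completeX 𝕜 G (t + 1)) Λ (X (Sum.inr u) * (X (Sum.inr v) * F)) =
        Λ (completeX 𝕜 (G \ {u, v}) (t + 1) * (X (Sum.inr u) * (X (Sum.inr v) * F))) := by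
    have := h.completeX_sdiff {u, v} (P := G) (by rwa [Finset.union_empty]) t F
    rwa [Finset.prod_pair huv, mul_assoc] at this
  have hex : exchange 𝕜 u v (completeX 𝕜 (G \ {u, v}) (t + 1) *
      (X (Sum.inr u) * (X (Sum.inr v) * F))) = completeX 𝕜 (G \ {u, v}) (t + 1) *
      (X (Sum.inr u) * (X (Sum.inr v) * exchange 𝕜 u v F)) := by
    rw [map_mul, exchange_completeX u v _ (by simp), map_mul, map_mul, exchange_inr, exchange_inr,
      Equiv.swap_apply_left, Equiv.swap_apply_right, mul_left_comm (X (Sum.inr v))]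
  rw [hred, hred, ← h.anti u hu v hv huv, hex]

/-- The polynomial acts as the top power x^(l+1) at a place of G still to be chosen: the one left
without y. -/
theorem mul_completeX (h : HookFunctional R ∅ k (l + 1) Λ) {G : Finset ι} (hG : G ⊆ R)
    (hGn : G.Nonempty) :
    HookFunctional (R \ G) G k l (mulFunctional (completeX 𝕜 G (l + 1)) Λ) := by
  have hU : R \ G ∪ G = R := Finset.sdiff_union_of_subset hG
  have hR : R ∪ ∅ = R := Finset.union_empty R
  constructor
  case disjoint => exact Finset.sdiff_disjoint
  case x_pow =>
    intro q hq F
    obtain ⟨hqR, hqG⟩ := Finset.mem_sdiff.1 hq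
    rw [mulFunctional_apply, mul_left_comm]
    -- Using x_q^(l+1) first lowers the bound to l, and then h_(l+1) has killing degree.
    exact (h.mul_x hqR).completeX_eq_zero (fun p hp =>
      Finset.mem_erase.2 ⟨ne_of_mem_of_not_mem hp hqG, hG hp⟩) F
  case y_pow =>
    intro q hq F
    rw [hU] at hq
    rw [mulFunctional_apply, mul_left_comm]
    exact h.y_pow q (by rwa [hR]) _
  case x_mul_y =>
    intro q hq F
    rw [mulFunctional_apply, mul_left_comm, mul_left_comm (completeX 𝕜 G (l + 1))]
    exact h.x_mul_y q (Finset.mem_sdiff.1 hq).1 _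
  case x_pending => exact fun q hq F => h.completeX_mul_x_eq_zero hG hq F
  case anti =>
    intro u hu v hv huv F
    obtain ⟨huR, huG⟩ := Finset.mem_sdiff.1 hu
    obtain ⟨hvR, hvG⟩ := Finset.mem_sdiff.1 hv
    simp only [mulFunctional_apply]
    rw [← h.anti u huR v hvR huv, map_mul (exchange 𝕜 u v),
      exchange_completeX u v G (by simp [huG, hvG])]
  case anti_y =>
    intro u hu v hv huv F
    rw [hU] at hu hv
    exact h.completeX_anti_y hG hu hv huv F
  case y_pending =>
    intro _ F
    rw [mulFunctional_apply, h.completeX_sdiff G (by rwa [hR]), Finset.sdiff_self,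
      completeX_empty (Nat.succ_ne_zero _), zero_mul, map_zero]
  case arrangement =>
    intro E hE hE1 v hinj hv hZ
    obtain ⟨j, rfl⟩ := Finset.card_eq_one.1 (hE1 hGn)
    rw [Finset.singleton_subset_iff] at hE
    rw [hU, Finset.sdiff_singleton_eq_erase] at hinj hv ⊢
    rw [Finset.sdiff_singleton_eq_erase] at hZ
    have hsub : G.erase j ⊆ R.erase j := Finset.erase_subset_erase j hG
    have hdvd : (∏ q ∈ G.erase j, (X (Sum.inr q) : MvPolynomial (ι ⊕ ι) 𝕜)) ∣
        ∏ p ∈ R.erase j, token 𝕜 p (v p) :=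
      (Finset.prod_dvd_prod_of_dvd _ (fun p => token 𝕜 p (v p)) fun q hq =>
        (dvd_pow_self _ (hZ q hq).ne').mul_left _).trans
        (Finset.prod_dvd_prod_of_subset _ _ _ hsub)
    have hval : ∀ q ∈ R.erase j, Function.update v j (l + 1, 0) q = v q := fun q hq =>
      Function.update_of_ne (Finset.ne_of_mem_erase hq) _ _
    have hRj : (R ∪ ∅) \ ∅ = insert j (R.erase j) := by
      rw [hR, Finset.sdiff_empty, Finset.insert_erase (hG hE)]
    -- All of G except j carries y, so the polynomial becomes x_j^(l+1) and j receives the cell (l +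
    -- 1, 0).
    have := h.arrangement ∅ subset_rfl (by simp) (Function.update v j (l + 1, 0)) ?_ ?_ (by simp)
    · rw [hRj, Finset.prod_insert (Finset.notMem_erase _ _), Function.update_self,
        Finset.prod_congr rfl fun q hq => by rw [hval q hq]] at this
      obtain ⟨F, hF⟩ := hdvd
      rw [mulFunctional_apply, hF, h.completeX_sdiff _ (by rwa [hR]), ← hF,
        Finset.sdiff_erase_self hE, completeX_singleton]
      simpa [token] using this
    · rw [hRj, Finset.coe_insert, Set.injOn_insert (by simp)]
      refine ⟨hinj.congr fun q hq => (hval q hq).symm, ?_⟩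
      rintro ⟨q, hq, hqv⟩
      rw [hval q hq, Function.update_self] at hqv
      have := (hv q hq).1
      rw [hqv] at this
      simp at this
    · intro q hq
      rw [hRj, Finset.mem_insert] at hq
      rcases hq with rfl | hq
      · simp
      · rw [hval q hq]
        obtain ⟨h1, h2, h3⟩ := hv q hq
        exact ⟨by omega, h2, h3⟩

end HookFunctional

end AntisymmetricFunctional

/-! ### Construction of T, column by column. -/

section Separation

variable {𝕜 : Type*} [Field 𝕜] {m : ℕ}

/-- The exponents of `x_p` and `y_p` contributed by a column with `c p` crosses at place `p`. -/
def columnToken (Y : Finset (Fin m)) (c : Fin m → ℕ) (p : Fin m) : ℕ × ℕ :=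
  if p ∈ Y then (0, c p) else (c p, 0)

/-- The monomial with exponents `S p` at the places `p ≥ i`. -/
noncomputable def tailMonomial (𝕜 : Type*) [Field 𝕜] (i : ℕ) (S : Fin m → ℕ × ℕ) :
    MvPolynomial (Fin (m + 1) ⊕ Fin (m + 1)) 𝕜 :=
  ∏ p ∈ Finset.univ.filter (fun p : Fin m => i ≤ p), token 𝕜 p.castSucc (S p)

/-- The places `≥ i`, including the extra last one. -/
def placesFrom (m i : ℕ) : Finset (Fin (m + 1)) :=
  Finset.univ.filter fun p => i ≤ (p : ℕ)

/-- The number of `y`-columns at the places `≥ i`. -/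
def yCount (Y : Finset (Fin m)) (i : ℕ) : ℕ :=
  (Finset.univ.filter fun p : Fin m => i ≤ p ∧ p ∈ Y).card

/-- The number of `x`-columns at the places `≥ i`. -/
def xCount (Y : Finset (Fin m)) (i : ℕ) : ℕ :=
  (Finset.univ.filter fun p : Fin m => i ≤ p ∧ p ∉ Y).card

theorem columnSize_of_mem {Y : Finset (Fin m)} {p : Fin m} (hp : p ∈ Y) :
    columnSize Y p = yCount Y p := by
  simp [columnSize, yCount, hp]

theorem columnSize_of_notMem {Y : Finset (Fin m)} {p : Fin m} (hp : p ∉ Y) :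
    columnSize Y p = xCount Y p := by
  simp [columnSize, xCount, hp]

theorem filter_le_eq_insert (P : Fin m → Prop) [DecidablePred P] (p : Fin m) (hp : P p) :
    (Finset.univ.filter fun q : Fin m => (p : ℕ) ≤ q ∧ P q) =
      insert p (Finset.univ.filter fun q : Fin m => (p : ℕ) + 1 ≤ q ∧ P q) := by
  ext q
  simp only [Finset.mem_filter, Finset.mem_univ, true_and, Finset.mem_insert, Fin.ext_iff]
  constructor
  · rintro ⟨h1, h2⟩
    rcases h1.eq_or_lt with h | h
    · exact Or.inl h.symm
    · exact Or.inr ⟨h, h2⟩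
  · rintro (h | ⟨h1, h2⟩)
    · rw [← Fin.ext_iff] at h
      subst h
      exact ⟨le_rfl, hp⟩
    · exact ⟨by omega, h2⟩

theorem filter_le_eq_of_not (P : Fin m → Prop) [DecidablePred P] (p : Fin m) (hp : ¬ P p) :
    (Finset.univ.filter fun q : Fin m => (p : ℕ) ≤ q ∧ P q) =
      Finset.univ.filter fun q : Fin m => (p : ℕ) + 1 ≤ q ∧ P q := by
  ext q
  simp only [Finset.mem_filter, Finset.mem_univ, true_and]
  refine ⟨fun ⟨h1, h2⟩ => ⟨?_, h2⟩, fun ⟨h1, h2⟩ => ⟨by omega, h2⟩⟩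
  rcases h1.eq_or_lt with h | h
  · rw [← Fin.ext_iff] at h
    subst h
    exact absurd h2 hp
  · exact h

theorem yCount_of_mem {Y : Finset (Fin m)} {p : Fin m} (hp : p ∈ Y) :
    yCount Y p = yCount Y (p + 1) + 1 := by
  rw [yCount, filter_le_eq_insert _ p hp, Finset.card_insert_of_notMem (by simp), yCount]

theorem yCount_of_notMem {Y : Finset (Fin m)} {p : Fin m} (hp : p ∉ Y) :
    yCount Y p = yCount Y (p + 1) := by
  rw [yCount, filter_le_eq_of_not _ p hp, yCount]

theorem xCount_of_mem {Y : Finset (Fin m)} {p : Fin m} (hp : p ∈ Y) :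
    xCount Y p = xCount Y (p + 1) := by
  rw [xCount, filter_le_eq_of_not _ p (not_not.2 hp), xCount]

theorem xCount_of_notMem {Y : Finset (Fin m)} {p : Fin m} (hp : p ∉ Y) :
    xCount Y p = xCount Y (p + 1) + 1 := by
  rw [xCount, filter_le_eq_insert _ p hp, Finset.card_insert_of_notMem (by simp), xCount]

theorem tailMonomial_eq_mul (S : Fin m → ℕ × ℕ) (p : Fin m) :
    tailMonomial 𝕜 p S = token 𝕜 p.castSucc (S p) * tailMonomial 𝕜 (p + 1) S := by
  have := filter_le_eq_insert (fun _ => True) p trivial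
  simp only [and_true] at this
  rw [tailMonomial, this, Finset.prod_insert (by simp), tailMonomial]

theorem placesFrom_erase (p : Fin m) :
    (placesFrom m p).erase p.castSucc = placesFrom m (p + 1) := by
  ext q
  simp only [placesFrom, Finset.mem_erase, Finset.mem_filter, Finset.mem_univ, true_and, ne_eq,
    Fin.ext_iff, Fin.val_castSucc]
  omega

theorem castSucc_mem_placesFrom {i : ℕ} {p : Fin m} : p.castSucc ∈ placesFrom m i ↔ i ≤ p := by
  simp [placesFrom]

/-- Some element of the form `F ↦ Λ (F * T)` detects the monomial of the columns at the places
`≥ i` and kills all lexicographically larger monomials. -/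
def Separates (Y : Finset (Fin m)) (c : Fin m → ℕ) (i : ℕ)
    (Λ : MvPolynomial (Fin (m + 1) ⊕ Fin (m + 1)) 𝕜 →ₗ[𝕜] 𝕜) : Prop :=
  ∃ T, Λ (tailMonomial 𝕜 i (columnToken Y c) * T) ≠ 0 ∧
    ∀ S : Fin m → ℕ × ℕ,
      (∃ p : Fin m, i ≤ p ∧ (∀ q : Fin m, i ≤ q → q < p → S q = columnToken Y c q) ∧
        toLex (columnToken Y c p) < toLex (S p)) → Λ (tailMonomial 𝕜 i S * T) = 0

variable {Y : Finset (Fin m)} {c : Fin m → ℕ}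
  {Λ : MvPolynomial (Fin (m + 1) ⊕ Fin (m + 1)) 𝕜 →ₗ[𝕜] 𝕜}

theorem Separates.of_mul {i : ℕ} (G : MvPolynomial (Fin (m + 1) ⊕ Fin (m + 1)) 𝕜)
    (h : Separates Y c i (mulFunctional G Λ)) : Separates Y c i Λ := by
  obtain ⟨T, hT, hS⟩ := h
  refine ⟨G * T, ?_, fun S h => ?_⟩
  · rwa [mul_left_comm]
  · rw [mul_left_comm]
    exact hS S h

/-- T receives the completing exponent `w` at p. A first difference at p is handled by `hkill`, a
later one by the smaller functional. -/
theorem Separates.step (p : Fin m) (w : ℕ × ℕ)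
    (h : Separates Y c (p + 1) (mulFunctional
      (token 𝕜 p.castSucc (columnToken Y c p) * token 𝕜 p.castSucc w) Λ))
    (hkill : ∀ s, toLex (columnToken Y c p) < toLex s → ∀ F,
      Λ (token 𝕜 p.castSucc s * (token 𝕜 p.castSucc w * F)) = 0) :
    Separates Y c p Λ := by
  obtain ⟨T, hT, hS⟩ := h
  refine ⟨token 𝕜 p.castSucc w * T, ?_, ?_⟩
  · rwa [mulFunctional_apply, mul_assoc, mul_left_comm (token 𝕜 _ w), ← mul_assoc,
      ← tailMonomial_eq_mul] at hT
  · rintro S ⟨q, hq, heq, hlt⟩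
    rw [tailMonomial_eq_mul]
    rcases hq.eq_or_lt with h | h
    · rw [← Fin.ext_iff] at h
      subst h
      rw [mul_assoc, mul_left_comm (tailMonomial 𝕜 _ S)]
      exact hkill _ hlt _
    · have := hS S ⟨q, h, fun r hr => heq r (by omega), hlt⟩
      rwa [mulFunctional_apply, mul_assoc, mul_left_comm (token 𝕜 _ w), ← mul_assoc,
        ← heq p le_rfl (Fin.lt_def.2 h)] at this

/-- An additional x meets the completing y^w unless w = 0; the full column is the only case needing
`hx`. -/
theorem HookFunctional.kill_y {R Z : Finset (Fin (m + 1))} {k l : ℕ}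
    (h : HookFunctional R Z k l Λ) {p : Fin (m + 1)} (hp : p ∈ R ∪ Z) {b w : ℕ} (hbw : b + w = k)
    (hx : w = 0 → ∀ F, Λ (X (Sum.inl p) * F) = 0) (s : ℕ × ℕ) (hs : toLex (0, b) < toLex s)
    (F : MvPolynomial (Fin (m + 1) ⊕ Fin (m + 1)) 𝕜) :
    Λ (token 𝕜 p s * (token 𝕜 p (0, w) * F)) = 0 := by
  obtain ⟨s₁, s₂⟩ := s
  rw [Prod.Lex.toLex_lt_toLex] at hs
  simp only [token, pow_zero, one_mul]
  rcases hs with hs | ⟨hs, hs'⟩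
  · rcases Nat.eq_zero_or_pos w with hw | hw
    · obtain ⟨a, rfl⟩ := Nat.exists_eq_succ_of_ne_zero (Nat.ne_of_gt hs)
      rw [← hx hw (X (Sum.inl p) ^ a * X (Sum.inr p) ^ s₂ * (X (Sum.inr p) ^ w * F))]
      congr 1
      rw [pow_succ]; ring
    · rw [← h.x_pow_mul_y hp (Nat.ne_of_gt hs) hw.ne' (X (Sum.inr p) ^ s₂ * F)]
      congr 1; ring
  · simp only at hs hs'
    rw [← hs, pow_zero, one_mul, ← mul_assoc, ← pow_add]
    exact h.y_pow_of_lt hp (by omega) F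

/-- If the x-exponents agree, the product contains x^l, and l ≠ 0 makes the additional y die. -/
theorem HookFunctional.kill_x {R Z : Finset (Fin (m + 1))} {k l : ℕ}
    (h : HookFunctional R Z k l Λ) {p : Fin (m + 1)} (hp : p ∈ R) {a w : ℕ} (haw : a + w = l)
    (hl : l ≠ 0) (s : ℕ × ℕ) (hs : toLex (a, 0) < toLex s)
    (F : MvPolynomial (Fin (m + 1) ⊕ Fin (m + 1)) 𝕜) :
    Λ (token 𝕜 p s * (token 𝕜 p (w, 0) * F)) = 0 := by
  obtain ⟨s₁, s₂⟩ := s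
  rw [Prod.Lex.toLex_lt_toLex] at hs
  simp only [token, pow_zero, mul_one]
  have key : X (Sum.inl p) ^ s₁ * X (Sum.inr p) ^ s₂ * (X (Sum.inl p) ^ w * F) =
      X (Sum.inl p) ^ (s₁ + w) * (X (Sum.inr p) ^ s₂ * F) := by
    rw [pow_add]; ring
  rw [key]
  rcases hs with hs | ⟨hs, hs'⟩
  · exact h.x_pow_of_lt hp (by simp only at hs; omega) _
  · simp only at hs hs'
    exact h.x_pow_mul_y (Finset.mem_union_left _ hp) (by omega) hs'.ne' F

theorem token_mul_token {ι : Type*} (p : ι) (v w : ℕ × ℕ) :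
    token 𝕜 p v * token 𝕜 p w = token 𝕜 p (v + w) := by
  simp only [token, Prod.fst_add, Prod.snd_add, pow_add]
  ring

/-- The places `≥ i` of the full `y`-columns to the left of `j`, together with `j`. -/
def pendingPlaces (Y : Finset (Fin m)) (c : Fin m → ℕ) (i : ℕ) (j : Fin m) :
    Finset (Fin (m + 1)) :=
  insert j.castSucc ((Finset.univ.filter fun q : Fin m =>
    i ≤ q ∧ q < j ∧ q ∈ Y ∧ c q = columnSize Y q).map Fin.castSuccEmb)

theorem castSucc_mem_pendingPlaces {i : ℕ} {j q : Fin m} :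
    q.castSucc ∈ pendingPlaces Y c i j ↔
      q = j ∨ (i ≤ q ∧ q < j ∧ q ∈ Y ∧ c q = columnSize Y q) := by
  simp [pendingPlaces]

theorem last_notMem_pendingPlaces (i : ℕ) (j : Fin m) :
    Fin.last m ∉ pendingPlaces Y c i j := by
  simp [pendingPlaces, Fin.castSucc_ne_last, (Fin.castSucc_ne_last _).symm]

theorem pendingPlaces_erase {j p : Fin m} (hpj : p < j) :
    (pendingPlaces Y c p j).erase p.castSucc = pendingPlaces Y c (p + 1) j := by
  ext q
  induction q using Fin.lastCases with
  | last => simp [last_notMem_pendingPlaces]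
  | cast q =>
    rw [Finset.mem_erase, castSucc_mem_pendingPlaces, castSucc_mem_pendingPlaces]
    simp only [ne_eq, Fin.castSucc_inj]
    constructor
    · rintro ⟨h1, h2 | ⟨h2, h3⟩⟩
      · exact Or.inl h2
      · exact Or.inr ⟨by rw [Fin.ext_iff] at h1; omega, h3⟩
    · rintro (rfl | ⟨h2, h3⟩)
      · exact ⟨hpj.ne', Or.inl rfl⟩
      · exact ⟨by rw [Fin.ext_iff]; omega, Or.inr ⟨by omega, h3⟩⟩

theorem pendingPlaces_self (j : Fin m) : pendingPlaces Y c j j = {j.castSucc} := by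
  ext q
  induction q using Fin.lastCases with
  | last => simp [last_notMem_pendingPlaces, (Fin.castSucc_ne_last _).symm]
  | cast q =>
    rw [castSucc_mem_pendingPlaces, Finset.mem_singleton, Fin.castSucc_inj]
    refine ⟨?_, Or.inl⟩
    rintro (h | ⟨h1, h2, -⟩)
    · exact h
    · exact absurd h2 (not_lt.2 h1)

theorem pendingPlaces_subset {i : ℕ} {j : Fin m} (hij : i ≤ j) :
    pendingPlaces Y c i j ⊆ placesFrom m i := by
  intro q hq
  induction q using Fin.lastCases with
  | last => exact absurd hq (last_notMem_pendingPlaces _ _)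
  | cast q =>
    rw [castSucc_mem_pendingPlaces] at hq
    rw [castSucc_mem_placesFrom]
    rcases hq with rfl | hq
    exacts [hij, hq.1]

variable [CharZero 𝕜]

/-- The state with pending places. Here l is one less than the number of x-columns left, since the
symmetric polynomial has used one top power on behalf of the white column j. -/
theorem separates_of_open (hc : ∀ p, c p ≤ columnSize Y p) {i j : Fin m} {l : ℕ}
    (ih : (∀ Λ : MvPolynomial (Fin (m + 1) ⊕ Fin (m + 1)) 𝕜 →ₗ[𝕜] 𝕜,
        HookFunctional (placesFrom m (i + 1)) ∅ (yCount Y (i + 1)) (xCount Y (i + 1)) Λ →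
          Separates Y c (i + 1) Λ) ∧
      ∀ (Λ : MvPolynomial (Fin (m + 1) ⊕ Fin (m + 1)) 𝕜 →ₗ[𝕜] 𝕜) (l : ℕ),
        (i : ℕ) + 1 ≤ j → xCount Y (i + 1) = l + 1 →
        HookFunctional (placesFrom m (i + 1) \ pendingPlaces Y c (i + 1) j)
          (pendingPlaces Y c (i + 1) j) (yCount Y (i + 1)) l Λ → Separates Y c (i + 1) Λ)
    (hij : i ≤ j) (hj : j ∉ Y) (hcj : c j = 0)
    (hnu : ∀ p, i ≤ p → p < j → p ∉ Y → ¬ IsUniform Y c p) (hl : xCount Y i = l + 1)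
    (h : HookFunctional (placesFrom m i \ pendingPlaces Y c i j) (pendingPlaces Y c i j)
      (yCount Y i) l Λ) : Separates Y c i Λ := by
  rcases hij.eq_or_lt with rfl | hlt
  · rw [pendingPlaces_self, Finset.sdiff_singleton_eq_erase, placesFrom_erase,
      yCount_of_notMem hj] at h
    rw [xCount_of_notMem hj, Nat.add_right_cancel_iff] at hl
    -- Only j is pending: any x or y there dies, so T needs no factor at j.
    refine Separates.step i 0 ?_ ?_
    · have h0 : token 𝕜 i.castSucc (columnToken Y c i) * token 𝕜 i.castSucc 0 = 1 := by
        simp [token, columnToken, hj, hcj]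
      rw [h0]
      refine ih.1 _ ?_
      rw [hl]
      have h1 : mulFunctional 1 Λ = Λ :=
        LinearMap.ext fun F => by rw [mulFunctional_apply, one_mul]
      rw [h1]
      exact h.close
    · intro s hs F
      obtain ⟨s₁, s₂⟩ := s
      rw [columnToken, if_neg hj, hcj, Prod.Lex.toLex_lt_toLex] at hs
      rcases hs with hs | ⟨hs, hs'⟩
      · obtain ⟨a, rfl⟩ := Nat.exists_eq_succ_of_ne_zero (Nat.ne_of_gt hs)
        rw [← h.x_pending i.castSucc (Finset.mem_singleton_self _) (X (Sum.inl i.castSucc) ^ a *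
          X (Sum.inr i.castSucc) ^ s₂ * (token 𝕜 i.castSucc 0 * F)), token]
        congr 1
        rw [pow_succ]; ring
      · obtain ⟨b, rfl⟩ := Nat.exists_eq_succ_of_ne_zero (Nat.ne_of_gt hs')
        rw [← h.y_pending (Finset.singleton_nonempty _) (X (Sum.inl i.castSucc) ^ s₁ *
          X (Sum.inr i.castSucc) ^ b * (token 𝕜 i.castSucc 0 * F)), Finset.prod_singleton, token]
        congr 1
        rw [pow_succ]; ring
  · have hmem : i.castSucc ∈ placesFrom m i := castSucc_mem_placesFrom.2 le_rfl
    have hR : (placesFrom m i \ pendingPlaces Y c i j).erase i.castSucc =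
        placesFrom m (i + 1) \ pendingPlaces Y c (i + 1) j := by
      rw [← pendingPlaces_erase hlt, ← placesFrom_erase]
      ext q
      simp only [Finset.mem_erase, Finset.mem_sdiff]
      tauto
    by_cases hi : i ∈ Y
    · have hU : i.castSucc ∈ placesFrom m i \ pendingPlaces Y c i j ∪ pendingPlaces Y c i j := by
        rwa [Finset.sdiff_union_of_subset (pendingPlaces_subset hij)]
      have hci : c i + (yCount Y i - c i) = yCount Y i := by
        have := hc i
        rw [columnSize_of_mem hi] at this
        omega
      refine Separates.step i (0, yCount Y i - c i) ?_ ?_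
      · rw [token_mul_token, columnToken, if_pos hi, Prod.mk_add_mk, hci, zero_add]
        refine ih.2 _ l hlt (by rw [← xCount_of_mem hi, hl]) ?_
        rw [yCount_of_mem hi] at h ⊢
        have := h.mul_y hU (fun heq => by
          have hjm : j.castSucc ∈ pendingPlaces Y c i j :=
            castSucc_mem_pendingPlaces.2 (Or.inl rfl)
          rw [heq, Finset.mem_singleton, Fin.castSucc_inj] at hjm
          exact hlt.ne' hjm)
        rw [hR, pendingPlaces_erase hlt] at this
        simpa [token] using this
      · intro s hs F
        rw [columnToken, if_pos hi] at hs
        -- A column with empty completion is full, hence pending.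
        refine h.kill_y hU hci (fun hw => h.x_pending _ ?_) s hs F
        rw [castSucc_mem_pendingPlaces]
        refine Or.inr ⟨le_rfl, hlt, hi, ?_⟩
        rw [columnSize_of_mem hi]
        omega
    · have hnu' := hnu i le_rfl hlt hi
      rw [IsUniform, not_or, columnSize_of_notMem hi] at hnu'
      have hle := hc i
      rw [columnSize_of_notMem hi] at hle
      have hiR : i.castSucc ∈ placesFrom m i \ pendingPlaces Y c i j := by
        rw [Finset.mem_sdiff, castSucc_mem_pendingPlaces]
        refine ⟨hmem, ?_⟩
        rintro (h1 | h1)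
        · exact hlt.ne h1
        · exact hi h1.2.2.1
      -- Non-uniformity gives 0 < c i < l + 1: the crosses fit under the lowered bound l, and l is
      -- positive.
      obtain ⟨l, rfl⟩ := Nat.exists_eq_succ_of_ne_zero (show l ≠ 0 by omega)
      have hci : c i + (l + 1 - c i) = l + 1 := by omega
      refine Separates.step i (l + 1 - c i, 0) ?_ ?_
      · rw [token_mul_token, columnToken, if_neg hi, Prod.mk_add_mk, hci, zero_add]
        refine ih.2 _ l hlt ?_ ?_
        · rw [xCount_of_notMem hi] at hl
          omega
        · have := h.mul_x hiR
          rw [hR, yCount_of_notMem hi] at this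
          have hpend : pendingPlaces Y c i j = pendingPlaces Y c (i + 1) j := by
            rw [← pendingPlaces_erase hlt, Finset.erase_eq_of_notMem (Finset.mem_sdiff.1 hiR).2]
          rw [hpend] at this
          simpa [token] using this
      · intro s hs F
        rw [columnToken, if_neg hi] at hs
        exact h.kill_x hiR hci (Nat.succ_ne_zero _) s hs F

omit [CharZero 𝕜] in
-- The last x-column has depth 1 and is therefore uniform; take the leftmost uniform one.
theorem exists_isFirstUniformX (hc : ∀ p, c p ≤ columnSize Y p) {i : Fin m} (hi : i ∈ Y)
    (hx : xCount Y i ≠ 0) : ∃ j, IsFirstUniformX Y c i j := by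
  classical
  obtain ⟨p, hp⟩ := Finset.card_ne_zero.1 hx
  set A := Finset.univ.filter fun p : Fin m => (i : ℕ) ≤ p ∧ p ∉ Y with hA
  have hlast := Finset.max'_mem A ⟨p, hp⟩
  set j := A.max' ⟨p, hp⟩ with hj
  obtain ⟨hij, hjY⟩ := (Finset.mem_filter.1 hlast).2
  have hij : i < j := lt_of_le_of_ne hij (fun h => hjY (h ▸ hi))
  have hsize : columnSize Y j ≤ 1 := by
    rw [columnSize_of_notMem hjY, xCount, Finset.card_le_one]
    have hq : ∀ q ∈ Finset.univ.filter (fun q : Fin m => (j : ℕ) ≤ q ∧ q ∉ Y), q = j := by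
      intro q hq
      obtain ⟨h1, h2⟩ := (Finset.mem_filter.1 hq).2
      exact le_antisymm (Finset.le_max' A q (Finset.mem_filter.2
        ⟨Finset.mem_univ _, hij.le.trans h1, h2⟩)) h1
    intro q hq' r hr
    rw [hq q hq', hq r hr]
  have hU : (Finset.univ.filter fun q => i < q ∧ q ∉ Y ∧ IsUniform Y c q).Nonempty := by
    refine ⟨j, Finset.mem_filter.2 ⟨Finset.mem_univ _, hij, hjY, ?_⟩⟩
    have := hc j
    unfold IsUniform
    omega
  have hmin := Finset.min'_mem _ hU
  obtain ⟨h1, h2, h3⟩ := (Finset.mem_filter.1 hmin).2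
  refine ⟨_, h1, h2, h3, fun k hik hk hkY hku => ?_⟩
  exact absurd (Finset.min'_le _ k (Finset.mem_filter.2 ⟨Finset.mem_univ _, hik, hkY, hku⟩))
    (not_le.2 hk)

/-- The state without pending places. A full y-column followed by x-columns switches to the open
state at the same place; every other column is completed by a power. -/
theorem separates_of_closed (hc : ∀ p, c p ≤ columnSize Y p)
    (hfull : ∀ i ∈ Y, ∀ j, IsFirstUniformX Y c i j → c j = columnSize Y j →
      c i < columnSize Y i) {i : Fin m}
    (ih : ∀ Λ : MvPolynomial (Fin (m + 1) ⊕ Fin (m + 1)) 𝕜 →ₗ[𝕜] 𝕜,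
        HookFunctional (placesFrom m (i + 1)) ∅ (yCount Y (i + 1)) (xCount Y (i + 1)) Λ →
          Separates Y c (i + 1) Λ)
    (hopen : ∀ (j : Fin m) (Λ : MvPolynomial (Fin (m + 1) ⊕ Fin (m + 1)) 𝕜 →ₗ[𝕜] 𝕜) (l : ℕ),
        i ≤ j → j ∉ Y → c j = 0 → (∀ p, i ≤ p → p < j → p ∉ Y → ¬ IsUniform Y c p) →
        xCount Y i = l + 1 →
        HookFunctional (placesFrom m i \ pendingPlaces Y c i j) (pendingPlaces Y c i j)
          (yCount Y i) l Λ → Separates Y c i Λ)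
    (h : HookFunctional (placesFrom m i) ∅ (yCount Y i) (xCount Y i) Λ) :
    Separates Y c i Λ := by
  have hmem : i.castSucc ∈ placesFrom m i := castSucc_mem_placesFrom.2 le_rfl
  have hle := hc i
  by_cases hi : i ∈ Y
  · rw [columnSize_of_mem hi] at hle
    by_cases hpend : c i = yCount Y i ∧ xCount Y i ≠ 0
    · obtain ⟨hci, hx⟩ := hpend
      obtain ⟨j, hij⟩ := exists_isFirstUniformX hc hi hx
      -- A crossed column j would force a white cell in the full column i.
      have hcj : c j = 0 := by
        rcases hij.2.2.1 with h0 | h0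
        · exact h0
        · have := hfull i hi j hij h0
          rw [columnSize_of_mem hi] at this
          omega
      obtain ⟨l, hl⟩ := Nat.exists_eq_succ_of_ne_zero hx
      rw [hl] at h
      refine Separates.of_mul (completeX 𝕜 (pendingPlaces Y c i j) (l + 1))
        (hopen j _ l hij.1.le hij.2.1 hcj ?_ hl
          (h.mul_completeX (pendingPlaces_subset hij.1.le) ⟨_, Finset.mem_insert_self _ _⟩))
      intro p hp hpj hpY
      exact hij.2.2.2 p (lt_of_le_of_ne hp fun heq => hpY (heq ▸ hi)) hpj hpY
    · have hU : i.castSucc ∈ placesFrom m i ∪ ∅ := by rwa [Finset.union_empty]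
      have hci : c i + (yCount Y i - c i) = yCount Y i := by omega
      refine Separates.step i (0, yCount Y i - c i) ?_ ?_
      · rw [token_mul_token, columnToken, if_pos hi, Prod.mk_add_mk, hci, zero_add]
        refine ih _ ?_
        rw [yCount_of_mem hi, xCount_of_mem hi] at h
        rw [yCount_of_mem hi]
        have := h.mul_y hU (Finset.singleton_ne_empty _).symm
        rw [placesFrom_erase, Finset.erase_empty] at this
        simpa [token] using this
      · intro s hs F
        rw [columnToken, if_pos hi] at hs
        -- A full column in this case has no x-column to its right, so the bound on x-exponents is
        -- 0.
        refine h.kill_y hU hci (fun hw G => ?_) s hs F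
        rw [← pow_one (X (Sum.inl _))]
        exact h.x_pow_of_lt hmem (by omega) G
  · rw [columnSize_of_notMem hi] at hle
    have hci : c i + (xCount Y i - c i) = xCount Y i := by omega
    have hx := xCount_of_notMem hi
    refine Separates.step i (xCount Y i - c i, 0) ?_ ?_
    · rw [token_mul_token, columnToken, if_neg hi, Prod.mk_add_mk, hci, zero_add]
      refine ih _ ?_
      rw [yCount_of_notMem hi, hx] at h
      rw [hx]
      have := h.mul_x hmem
      rw [placesFrom_erase] at this
      simpa [token] using this
    · intro s hs F
      rw [columnToken, if_neg hi] at hs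
      exact h.kill_x hmem hci (by omega) s hs F

omit [CharZero 𝕜] in
theorem separates_of_last (h : HookFunctional (placesFrom m m) ∅ (yCount Y m) (xCount Y m) Λ) :
    Separates Y c m Λ := by
  have hempty : (Finset.univ.filter fun p : Fin m => m ≤ (p : ℕ)) = ∅ :=
    Finset.filter_false_of_mem fun p _ => not_le.2 p.isLt
  refine ⟨1, ?_, fun S => ?_⟩
  · have hlast : placesFrom m m = {Fin.last m} := by
      ext p
      simp only [placesFrom, Finset.mem_filter, Finset.mem_univ, true_and, Finset.mem_singleton,
        Fin.ext_iff, Fin.val_last]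
      omega
    have := h.arrangement ∅ subset_rfl (by simp) 0
    rw [Finset.union_empty, Finset.sdiff_empty, hlast] at this
    rw [tailMonomial, hempty, Finset.prod_empty]
    simpa [token] using this (by simp) (by simp) (by simp)
  · rintro ⟨p, hp, -⟩
    exact absurd p.isLt (not_lt.2 hp)

theorem separates (hc : ∀ p, c p ≤ columnSize Y p)
    (hfull : ∀ i ∈ Y, ∀ j, IsFirstUniformX Y c i j → c j = columnSize Y j →
      c i < columnSize Y i)
    (h : HookFunctional (placesFrom m 0) ∅ (yCount Y 0) (xCount Y 0) Λ) :
    Separates Y c 0 Λ := by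
  -- Both states are treated in one induction on the number d of columns left, since each leads to
  -- the other.
  suffices H : ∀ d i : ℕ, i + d = m →
      (∀ Λ : MvPolynomial (Fin (m + 1) ⊕ Fin (m + 1)) 𝕜 →ₗ[𝕜] 𝕜,
        HookFunctional (placesFrom m i) ∅ (yCount Y i) (xCount Y i) Λ → Separates Y c i Λ) ∧
      ∀ (j : Fin m) (Λ : MvPolynomial (Fin (m + 1) ⊕ Fin (m + 1)) 𝕜 →ₗ[𝕜] 𝕜) (l : ℕ),
        i ≤ j → j ∉ Y → c j = 0 → (∀ p : Fin m, i ≤ p → p < j → p ∉ Y → ¬ IsUniform Y c p) →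
        xCount Y i = l + 1 →
        HookFunctional (placesFrom m i \ pendingPlaces Y c i j) (pendingPlaces Y c i j)
          (yCount Y i) l Λ → Separates Y c i Λ from
    (H m 0 (zero_add m)).1 Λ h
  intro d
  induction d with
  | zero =>
    rintro i rfl
    exact ⟨fun Λ h => separates_of_last h, fun j _ _ hij => absurd j.isLt (not_lt.2 hij)⟩
  | succ d IH =>
    intro i hi
    obtain ⟨i, rfl⟩ : ∃ p : Fin m, (p : ℕ) = i := ⟨⟨i, by omega⟩, rfl⟩
    obtain ⟨ihc, iho⟩ := IH (i + 1) (by omega)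
    have hopen : ∀ (j : Fin m) (Λ : MvPolynomial (Fin (m + 1) ⊕ Fin (m + 1)) 𝕜 →ₗ[𝕜] 𝕜) (l : ℕ),
        (i : ℕ) ≤ j → j ∉ Y → c j = 0 →
        (∀ p : Fin m, (i : ℕ) ≤ p → p < j → p ∉ Y → ¬ IsUniform Y c p) →
        xCount Y i = l + 1 →
        HookFunctional (placesFrom m i \ pendingPlaces Y c i j) (pendingPlaces Y c i j)
          (yCount Y i) l Λ → Separates Y c i Λ := by
      intro j Λ l hij hj hcj hnu hl h
      exact separates_of_open hc ⟨ihc, fun Λ l hij' hl' h' => iho j Λ l hij' hj hcj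
        (fun p hp => hnu p (by omega)) hl' h'⟩ hij hj hcj hnu hl h
    exact ⟨fun Λ h => separates_of_closed hc hfull ihc hopen h, hopen⟩

end Separation

/-! ### The differential pairing. -/

section Pairing

variable {σ 𝕜 : Type*} [Field 𝕜]

/-- The bilinear form `(F, f) ↦ (F(∂) f)(0)`, where `F(∂)` is the differential operator obtained
from `F` by substituting derivations for the variables. -/
noncomputable def diffPairing (σ 𝕜 : Type*) [Field 𝕜] :
    MvPolynomial σ 𝕜 →ₗ[𝕜] MvPolynomial σ 𝕜 →ₗ[𝕜] 𝕜 :=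
  (basisMonomials σ 𝕜).constr 𝕜 fun m => (m.prod fun _ e => (e.factorial : 𝕜)) • lcoeff 𝕜 m

theorem diffPairing_monomial (m : σ →₀ ℕ) (a : 𝕜) (f : MvPolynomial σ 𝕜) :
    diffPairing σ 𝕜 (monomial m a) f =
      a * ((m.prod fun _ e => (e.factorial : 𝕜)) * coeff m f) := by
  have h := (basisMonomials σ 𝕜).constr_basis 𝕜
    (fun m => (m.prod fun _ e => (e.factorial : 𝕜)) • lcoeff 𝕜 m) m
  rw [coe_basisMonomials] at h
  rw [← mul_one a, ← smul_eq_mul, ← smul_monomial, diffPairing, map_smul, h]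
  simp [lcoeff]

/-- The factor m_i + 1 produced by differentiation is the ratio of the two factorial weights. -/
theorem diffPairing_X_mul (i : σ) (F f : MvPolynomial σ 𝕜) :
    diffPairing σ 𝕜 (X i * F) f = diffPairing σ 𝕜 F (pderiv i f) := by
  classical
  induction F using MvPolynomial.induction_on' with
  | monomial m a =>
    rw [X, monomial_mul, one_mul, diffPairing_monomial, diffPairing_monomial, coeff_pderiv,
      add_comm (Finsupp.single i 1) m]
    have hprod : ((m + Finsupp.single i 1).prod fun _ e => (e.factorial : 𝕜)) =
        (m.prod fun _ e => (e.factorial : 𝕜)) * (m i + 1) := by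
      set s := insert i m.support with hs
      have hi : i ∈ s := Finset.mem_insert_self _ _
      rw [Finsupp.prod_of_support_subset m (s := s) (Finset.subset_insert _ _) _ (by simp),
        Finsupp.prod_of_support_subset (m + Finsupp.single i 1) (s := s) _ _ (by simp),
        ← Finset.mul_prod_erase s _ hi, ← Finset.mul_prod_erase s _ hi]
      · rw [Finset.prod_congr rfl (g := fun j => ((m j).factorial : 𝕜)) fun j hj => by
          rw [Finsupp.add_apply, Finsupp.single_eq_of_ne (Finset.ne_of_mem_erase hj), add_zero]]
        rw [Finsupp.add_apply, Finsupp.single_eq_same, Nat.factorial_succ]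
        push_cast
        ring
      · intro j hj
        rw [hs, Finset.mem_insert, Finsupp.mem_support_iff]
        by_contra hcon
        push Not at hcon
        rw [Finsupp.mem_support_iff, Finsupp.add_apply, hcon.2,
          Finsupp.single_eq_of_ne hcon.1] at hj
        exact hj rfl
    rw [hprod]
    ring
  | add F G hF hG => rw [mul_add, map_add, map_add, LinearMap.add_apply, LinearMap.add_apply, hF, hG]

theorem diffPairing_X_pow_mul (i : σ) (a : ℕ) (F f : MvPolynomial σ 𝕜) :
    diffPairing σ 𝕜 (X i ^ a * F) f =
      diffPairing σ 𝕜 F (((pderiv i : Derivation 𝕜 (MvPolynomial σ 𝕜) _) :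
        Module.End 𝕜 (MvPolynomial σ 𝕜)) ^ a <| f) := by
  induction a generalizing F with
  | zero => simp
  | succ a ih =>
    rw [pow_succ, mul_assoc, ih, diffPairing_X_mul, pow_succ', Module.End.mul_apply]
    rfl

end Pairing

/-! ### The determinant as a hook functional. -/

section Determinant

variable {𝕜 : Type*} [Field 𝕜]

/-- The exponents of the monomial with tokens `v p`. -/
noncomputable def tokenExponent {ι : Type*} [Finite ι] (v : ι → ℕ × ℕ) : ι ⊕ ι →₀ ℕ :=
  Finsupp.equivFunOnFinite.symm (Sum.elim (fun p => (v p).1) fun p => (v p).2)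

theorem tokenExponent_injective {ι : Type*} [Finite ι] :
    Function.Injective (tokenExponent : (ι → ℕ × ℕ) → ι ⊕ ι →₀ ℕ) := by
  intro v w h
  funext p
  have h1 := DFunLike.congr_fun h (Sum.inl p)
  have h2 := DFunLike.congr_fun h (Sum.inr p)
  exact Prod.ext h1 h2

variable {ι : Type*} [Fintype ι]

theorem prod_token (v : ι → ℕ × ℕ) :
    ∏ p, token 𝕜 p (v p) = monomial (tokenExponent v) 1 := by
  rw [monomial_eq, map_one, one_mul, Finsupp.prod_fintype _ _ (fun _ => pow_zero _),
    Fintype.prod_sum_type, ← Finset.prod_mul_distrib]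
  rfl

theorem tokenExponent_prod_factorial (v : ι → ℕ × ℕ) :
    ((tokenExponent v).prod fun _ e => (e.factorial : 𝕜)) =
      ∏ p, ((v p).1.factorial * (v p).2.factorial : 𝕜) := by
  rw [Finsupp.prod_fintype _ _ (fun _ => by simp), Fintype.prod_sum_type,
    ← Finset.prod_mul_distrib]
  rfl

variable [DecidableEq ι]

/-- The term of a permutation τ yields this monomial exactly when v ∘ τ = b, which is also when τ
contributes to the 0-1 determinant. -/
theorem coeff_det_token (b v : ι → ℕ × ℕ) :
    coeff (tokenExponent v) (Matrix.det (Matrix.of fun i j : ι =>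
      (X (Sum.inl i) : MvPolynomial (ι ⊕ ι) 𝕜) ^ (b j).1 * X (Sum.inr i) ^ (b j).2)) =
      Matrix.det (Matrix.of fun i j : ι => if v i = b j then (1 : 𝕜) else 0) := by
  rw [Matrix.det_apply, Matrix.det_apply, coeff_sum]
  refine Finset.sum_congr rfl fun τ _ => ?_
  rw [coeff_smul]
  congr 1
  have h1 : ∏ i, (Matrix.of fun i j : ι => (X (Sum.inl i) : MvPolynomial (ι ⊕ ι) 𝕜) ^ (b j).1 *
      X (Sum.inr i) ^ (b j).2) (τ i) i = ∏ p, token 𝕜 p (b (τ.symm p)) := by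
    rw [← Equiv.prod_comp τ fun p => token 𝕜 p (b (τ.symm p))]
    refine Finset.prod_congr rfl fun i _ => ?_
    rw [Equiv.symm_apply_apply]
    rfl
  rw [h1, prod_token (fun p => b (τ.symm p)), coeff_monomial]
  simp only [Matrix.of_apply]
  rw [Finset.prod_ite_zero, Finset.prod_const_one]
  have hiff : (tokenExponent fun p => b (τ.symm p)) = tokenExponent v ↔
      ∀ i ∈ Finset.univ, v (τ i) = b i := by
    simp only [tokenExponent_injective.eq_iff, Finset.mem_univ, forall_true_left, funext_iff]
    constructor
    · intro h i
      rw [← h, Equiv.symm_apply_apply]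
    · intro h p
      rw [← h, Equiv.apply_symm_apply]
  by_cases h : ∀ i ∈ Finset.univ, v (τ i) = b i
  · rw [if_pos (hiff.2 h), if_pos h]
  · rw [if_neg (mt hiff.1 h), if_neg h]

/-- The determinant `det (x_i ^ p_j * y_i ^ q_j)`. -/
noncomputable def biexponentDet (𝕜 : Type*) [Field 𝕜] (b : ι → ℕ × ℕ) : MvPolynomial (ι ⊕ ι) 𝕜 :=
  Matrix.det (Matrix.of fun i j : ι =>
    (X (Sum.inl i) : MvPolynomial (ι ⊕ ι) 𝕜) ^ (b j).1 * X (Sum.inr i) ^ (b j).2)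

theorem diffPairing_tokens (b v : ι → ℕ × ℕ) :
    diffPairing (ι ⊕ ι) 𝕜 (∏ p, token 𝕜 p (v p)) (biexponentDet 𝕜 b) =
      (∏ p, ((v p).1.factorial * (v p).2.factorial : 𝕜)) *
        Matrix.det (Matrix.of fun i j : ι => if v i = b j then (1 : 𝕜) else 0) := by
  rw [prod_token, diffPairing_monomial, one_mul, tokenExponent_prod_factorial, biexponentDet,
    coeff_det_token]

theorem diffPairing_tokens_eq_zero {b v : ι → ℕ × ℕ} {p : ι} (h : ∀ j, v p ≠ b j) :
    diffPairing (ι ⊕ ι) 𝕜 (∏ p, token 𝕜 p (v p)) (biexponentDet 𝕜 b) = 0 := by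
  rw [diffPairing_tokens, Matrix.det_eq_zero_of_row_eq_zero p (fun j => if_neg (h j)), mul_zero]

/-- Every monomial of the product has at q a pair outside the biexponents, which gives a zero row.
-/
theorem diffPairing_token_mul_eq_zero {b : ι → ℕ × ℕ} {q : ι} {w : ℕ × ℕ}
    (h : ∀ s j, s + w ≠ b j) (F : MvPolynomial (ι ⊕ ι) 𝕜) :
    diffPairing (ι ⊕ ι) 𝕜 (token 𝕜 q w * F) (biexponentDet 𝕜 b) = 0 := by
  refine linearMap_eq_zero_of_tokens
    (mulFunctional (token 𝕜 q w) ((diffPairing (ι ⊕ ι) 𝕜).flip (biexponentDet 𝕜 b)))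
    (fun v => ?_) F
  rw [mulFunctional_apply, LinearMap.flip_apply]
  have htok : token 𝕜 q w * ∏ p, token 𝕜 p (v p) =
      ∏ p, token 𝕜 p (Function.update v q (v q + w) p) := by
    rw [← Finset.mul_prod_erase _ _ (Finset.mem_univ q),
      ← Finset.mul_prod_erase _ (fun p => token 𝕜 p (Function.update v q (v q + w) p))
        (Finset.mem_univ q), ← mul_assoc, Function.update_self, mul_comm (token 𝕜 q w),
      token_mul_token]
    congr 1
    refine Finset.prod_congr rfl fun p hp => ?_
    rw [Function.update_of_ne (Finset.ne_of_mem_erase hp)]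
  rw [htok]
  refine diffPairing_tokens_eq_zero (p := q) fun j => ?_
  rw [Function.update_self]
  exact h _ j

theorem diffPairing_exchange (b : ι → ℕ × ℕ) {u v : ι} (huv : u ≠ v)
    (F : MvPolynomial (ι ⊕ ι) 𝕜) :
    diffPairing (ι ⊕ ι) 𝕜 (exchange 𝕜 u v F) (biexponentDet 𝕜 b) =
      -diffPairing (ι ⊕ ι) 𝕜 F (biexponentDet 𝕜 b) := by
  rw [eq_neg_iff_add_eq_zero]
  refine linearMap_eq_zero_of_tokens
    (((diffPairing (ι ⊕ ι) 𝕜).flip (biexponentDet 𝕜 b)) ∘ₗ (exchange 𝕜 u v).toLinearMap +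
      (diffPairing (ι ⊕ ι) 𝕜).flip (biexponentDet 𝕜 b)) (fun w => ?_) F
  rw [LinearMap.add_apply, LinearMap.comp_apply, AlgHom.toLinearMap_apply, LinearMap.flip_apply,
    LinearMap.flip_apply, map_prod]
  have htok : ∏ p, exchange 𝕜 u v (token 𝕜 p (w p)) =
      ∏ p, token 𝕜 p (w (Equiv.swap u v p)) := by
    rw [← Equiv.prod_comp (Equiv.swap u v)]
    refine Finset.prod_congr rfl fun p _ => ?_
    rw [exchange_token, Equiv.swap_apply_self]
  have hdet := Matrix.det_permute (Equiv.swap u v)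
    (Matrix.of fun i j : ι => if w i = b j then (1 : 𝕜) else 0)
  rw [Equiv.Perm.sign_swap huv] at hdet
  rw [htok, diffPairing_tokens b (fun p => w (Equiv.swap u v p)), diffPairing_tokens,
    Equiv.prod_comp (Equiv.swap u v) fun p => ((w p).1.factorial * (w p).2.factorial : 𝕜)]
  change _ * Matrix.det ((Matrix.of fun i j : ι => if w i = b j then (1 : 𝕜) else 0).submatrix
    (Equiv.swap u v) id) + _ = 0
  rw [hdet]
  push_cast
  ring

/-- The 0-1 matrix is a permutation matrix, and the factorials are non-zero in characteristic 0. -/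
theorem diffPairing_arrangement_ne_zero [CharZero 𝕜] {b v : ι → ℕ × ℕ}
    (hb : Function.Injective b) (hv : Function.Injective v) (h : ∀ p, ∃ j, v p = b j) :
    diffPairing (ι ⊕ ι) 𝕜 (∏ p, token 𝕜 p (v p)) (biexponentDet 𝕜 b) ≠ 0 := by
  choose τ hτ using h
  have hτi : Function.Injective τ := fun p q hpq => hv (by rw [hτ, hτ, hpq])
  set e : Equiv.Perm ι := Equiv.ofBijective τ (Finite.injective_iff_bijective.1 hτi)
  have hM : (Matrix.of fun i j : ι => if v i = b j then (1 : 𝕜) else 0) =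
      (1 : Matrix ι ι 𝕜).submatrix e id := by
    ext i j
    simp [Matrix.one_apply, hτ, hb.eq_iff, e]
  rw [diffPairing_tokens, hM, Matrix.det_permute, Matrix.det_one, mul_one]
  refine mul_ne_zero (Finset.prod_ne_zero_iff.2 fun p _ => ?_) ?_
  · exact mul_ne_zero (Nat.cast_ne_zero.2 (Nat.factorial_ne_zero _))
      (Nat.cast_ne_zero.2 (Nat.factorial_ne_zero _))
  · rcases Int.units_eq_one_or (Equiv.Perm.sign e) with h | h <;> simp [h]

theorem diffPairing_anti_y (b : ι → ℕ × ℕ) {u v : ι} (huv : u ≠ v)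
    (F : MvPolynomial (ι ⊕ ι) 𝕜) :
    diffPairing (ι ⊕ ι) 𝕜 (X (Sum.inr u) * (X (Sum.inr v) * exchange 𝕜 u v F))
        (biexponentDet 𝕜 b) =
      -diffPairing (ι ⊕ ι) 𝕜 (X (Sum.inr u) * (X (Sum.inr v) * F)) (biexponentDet 𝕜 b) := by
  rw [← diffPairing_exchange b huv, map_mul (exchange 𝕜 u v), map_mul (exchange 𝕜 u v),
    exchange_inr, exchange_inr, Equiv.swap_apply_left, Equiv.swap_apply_right, mul_left_comm]

theorem hookFunctional_biexponentDet [CharZero 𝕜] {b : ι → ℕ × ℕ} {k l : ℕ}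
    (hb : Function.Injective b)
    (hrange : ∀ t : ℕ × ℕ, (∃ j, b j = t) ↔ t.1 ≤ l ∧ t.2 ≤ k ∧ (t.1 = 0 ∨ t.2 = 0)) :
    HookFunctional Finset.univ ∅ k l
      ((diffPairing (ι ⊕ ι) 𝕜).flip (biexponentDet 𝕜 b)) := by
  have key (q : ι) (w : ℕ × ℕ)
      (hw : ∀ s : ℕ × ℕ, ¬ ((s + w).1 ≤ l ∧ (s + w).2 ≤ k ∧ ((s + w).1 = 0 ∨ (s + w).2 = 0)))
      (F : MvPolynomial (ι ⊕ ι) 𝕜) :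
      diffPairing (ι ⊕ ι) 𝕜 (token 𝕜 q w * F) (biexponentDet 𝕜 b) = 0 :=
    diffPairing_token_mul_eq_zero (fun s j hs => hw s ((hrange _).1 ⟨j, hs.symm⟩)) F
  obtain ⟨Λ, hΛ⟩ : ∃ Λ, Λ = (diffPairing (ι ⊕ ι) 𝕜).flip (biexponentDet 𝕜 b) := ⟨_, rfl⟩
  have happ (F : MvPolynomial (ι ⊕ ι) 𝕜) :
      Λ F = diffPairing (ι ⊕ ι) 𝕜 F (biexponentDet 𝕜 b) := by
    rw [hΛ, LinearMap.flip_apply]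
  rw [← hΛ]
  constructor
  case disjoint => exact Finset.disjoint_empty_right _
  case x_pow =>
    intro q _ F
    have := key q (l + 1, 0) (fun s hs => absurd hs.1 (by simp; omega)) F
    rw [token, pow_zero, mul_one] at this
    rw [happ, this]
  case y_pow =>
    intro q _ F
    have := key q (0, k + 1) (fun s hs => absurd hs.2.1 (by simp; omega)) F
    rw [token, pow_zero, one_mul] at this
    rw [happ, this]
  case x_mul_y =>
    intro q _ F
    have := key q (1, 1) (fun s hs => absurd hs.2.2 (by simp)) F
    rw [token, pow_one, pow_one, mul_assoc] at this
    rw [happ, this]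
  case x_pending => exact fun q hq => absurd hq (Finset.notMem_empty q)
  case anti =>
    intro u _ v _ huv F
    rw [happ, happ, diffPairing_exchange b huv]
  case anti_y =>
    intro u _ v _ huv F
    rw [happ, happ, diffPairing_anti_y b huv]
  case y_pending => exact fun h => absurd h Finset.not_nonempty_empty
  case arrangement =>
    intro E hE _ v hinj hv _
    obtain rfl := Finset.subset_empty.1 hE
    rw [Finset.union_empty, Finset.sdiff_empty] at hinj hv ⊢
    rw [Finset.coe_univ, Set.injOn_univ] at hinj
    rw [happ]
    refine diffPairing_arrangement_ne_zero hb hinj fun p => ?_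
    obtain ⟨j, hj⟩ := (hrange (v p)).2 (hv p (Finset.mem_univ p))
    exact ⟨j, hj.symm⟩

end Determinant

/-! ### Dessins and linear independence. -/

section Hook

variable {𝕜 : Type*} [Field 𝕜]

theorem biexponent_injective (μ : YoungDiagram) {n : ℕ} (hn : μ.card = n) :
    Function.Injective (biexponent μ hn) :=
  fun _ _ h => (Finset.orderEmbOfFin _ _).injective (ofLex.injective h)

theorem exists_biexponent_eq (μ : YoungDiagram) {n : ℕ} (hn : μ.card = n) (t : ℕ × ℕ) :
    (∃ j, biexponent μ hn j = t) ↔ t ∈ μ.cells := by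
  have h := Finset.range_orderEmbOfFin (μ.cells.map toLex.toEmbedding)
    ((Finset.card_map _).trans hn)
  have h' := Set.ext_iff.1 h (toLex t)
  rw [Finset.mem_coe, Finset.mem_map_equiv, toLex_symm_eq, ofLex_toLex] at h'
  rw [← h', Set.mem_range]
  exact exists_congr fun j => ⟨fun h => h ▸ rfl, fun h => by rw [biexponent, h, ofLex_toLex]⟩

theorem mem_hook_cells (K L : ℕ) (t : ℕ × ℕ) :
    t ∈ (hook K L).cells ↔ t.1 ≤ L ∧ t.2 ≤ K ∧ (t.1 = 0 ∨ t.2 = 0) := by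
  obtain ⟨a, b⟩ := t
  simp only [hook_cells, Finset.mem_union, Finset.mem_image, Finset.mem_range, Prod.mk.injEq]
  constructor
  · rintro (⟨j, hj, rfl, rfl⟩ | ⟨j, hj, rfl, rfl⟩)
    · exact ⟨by omega, by omega, Or.inl rfl⟩
    · exact ⟨by omega, by omega, Or.inr rfl⟩
  · rintro ⟨ha, hb, rfl | rfl⟩
    · exact Or.inl ⟨b, by omega, rfl, rfl⟩
    · rcases Nat.eq_zero_or_pos a with rfl | ha'
      · exact Or.inl ⟨0, by omega, rfl, rfl⟩
      · exact Or.inr ⟨a - 1, by omega, by omega, rfl⟩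

namespace Dessin

variable {K L : ℕ} (D : Dessin K L)

theorem mem_crossedCells (v : Fin (K + L) ⊕ Fin (K + L)) (t : ℕ) :
    (v, t) ∈ D.crossedCells ↔
      t < Sum.elim (fun p => (columnToken D.yPlaces D.crosses p).1)
        (fun p => (columnToken D.yPlaces D.crosses p).2) v := by
  simp only [crossedCells, Finset.mem_biUnion, Finset.mem_univ, true_and, Finset.mem_image,
    Finset.mem_range, Prod.mk.injEq]
  constructor
  · rintro ⟨i, s, hs, hv, rfl⟩
    rw [← hv]
    split_ifs with hi <;> simpa [columnToken, hi] using hs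
  · intro h
    rcases v with i | i
    · by_cases hi : i ∈ D.yPlaces
      · simp [columnToken, hi] at h
      · exact ⟨i, t, by simpa [columnToken, hi] using h, by simp [hi], rfl⟩
    · by_cases hi : i ∈ D.yPlaces
      · exact ⟨i, t, by simpa [columnToken, hi] using h, by simp [hi], rfl⟩
      · simp [columnToken, hi] at h

theorem cellCount_crossedCells (v : Fin (K + L) ⊕ Fin (K + L)) :
    cellCount D.crossedCells v = Sum.elim (fun p => (columnToken D.yPlaces D.crosses p).1)
        (fun p => (columnToken D.yPlaces D.crosses p).2) v := by
  set N := Sum.elim (fun p => (columnToken D.yPlaces D.crosses p).1)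
        (fun p => (columnToken D.yPlaces D.crosses p).2) v with hN
  have h : D.crossedCells.filter (fun c => c.1 = v) =
      (Finset.range N).map ⟨fun t => (v, t), fun _ _ h => (Prod.mk.inj h).2⟩ := by
    ext ⟨w, t⟩
    simp only [Finset.mem_filter, mem_crossedCells, Finset.mem_map, Finset.mem_range]
    constructor
    · rintro ⟨h, rfl⟩
      exact ⟨t, h, rfl⟩
    · rintro ⟨s, hs, h⟩
      obtain ⟨rfl, rfl⟩ := Prod.mk.inj h
      exact ⟨hs, rfl⟩
  rw [cellCount, h, Finset.card_map, Finset.card_range]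

end Dessin

/-- The exponents of `x_p` and `y_p` in `∂_S`. -/
def cellToken {m : ℕ} (S : Finset (DessinCell m)) (p : Fin m) : ℕ × ℕ :=
  (cellCount S (Sum.inl p), cellCount S (Sum.inr p))

theorem cellToken_crossedCells {K L : ℕ} (D : Dessin K L) :
    cellToken D.crossedCells = columnToken D.yPlaces D.crosses := by
  funext p
  simp [cellToken, D.cellCount_crossedCells]

/-- Crosses are stacked from the axis, so their numbers determine the set. -/
theorem cellToken_injOn (K L : ℕ) : Set.InjOn cellToken (crossedCellSets K L) := by
  rintro _ ⟨D, rfl⟩ _ ⟨E, rfl⟩ h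
  rw [cellToken_crossedCells, cellToken_crossedCells] at h
  ext ⟨v, t⟩
  rw [D.mem_crossedCells, E.mem_crossedCells, h]

theorem diffPairing_tailMonomial_mul {m : ℕ} (S : Finset (DessinCell m))
    (F f : MvPolynomial (Fin (m + 1) ⊕ Fin (m + 1)) 𝕜) :
    diffPairing _ 𝕜 (tailMonomial 𝕜 0 (cellToken S) * F) f = diffPairing _ 𝕜 F (derivOp 𝕜 S f) := by
  have hfilter : (Finset.univ.filter fun p : Fin m => 0 ≤ (p : ℕ)) = Finset.univ := by simp
  rw [tailMonomial, hfilter, Fin.prod_univ_def, derivOp]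
  induction List.finRange m generalizing F with
  | nil => simp
  | cons p l ih =>
    rw [List.map_cons, List.prod_cons, List.map_cons, List.prod_cons, mul_comm (token 𝕜 _ _),
      mul_assoc, ih, token, mul_comm (X (Sum.inl _) ^ _), mul_assoc, diffPairing_X_pow_mul,
      diffPairing_X_pow_mul, Module.End.mul_apply, Module.End.mul_apply]
    rfl

end Hook

theorem separates_biexponentDet (𝕜 : Type*) [Field 𝕜] [CharZero 𝕜] {K L : ℕ} (D : Dessin K L) :
    Separates D.yPlaces D.crosses 0
      ((diffPairing _ 𝕜).flip (Delta 𝕜 (hook K L) (hook_card K L))) := by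
  refine separates D.crosses_le D.lt_of_full ?_
  have h := hookFunctional_biexponentDet (𝕜 := 𝕜) (biexponent_injective _ (hook_card K L))
    (fun t => (exists_biexponent_eq _ (hook_card K L) t).trans (mem_hook_cells K L t))
  have hp : placesFrom (K + L) 0 = Finset.univ := by simp [placesFrom]
  have hy : yCount D.yPlaces 0 = K := by simp [yCount, D.card_yPlaces]
  have hx : xCount D.yPlaces 0 = L := by
    have : (Finset.univ.filter fun p : Fin (K + L) => 0 ≤ (p : ℕ) ∧ p ∉ D.yPlaces) = D.yPlacesᶜ := by
      ext p; simp
    rw [xCount, this, Finset.card_compl, D.card_yPlaces, Fintype.card_fin, Nat.add_sub_cancel_left]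
  rw [hp, hy, hx]
  exact h

/-- The tokens of `S`, read lexicographically from left to right. -/
def cellKey {m : ℕ} (S : Finset (DessinCell m)) : Lex (Fin m → ℕ ×ₗ ℕ) :=
  toLex fun p => toLex (cellToken S p)

theorem exists_separating (𝕜 : Type*) [Field 𝕜] [CharZero 𝕜] {K L : ℕ}
    {S : Finset (DessinCell (K + L))} (hS : S ∈ crossedCellSets K L) :
    ∃ T, diffPairing _ 𝕜 T (derivOp 𝕜 S (Delta 𝕜 (hook K L) (hook_card K L))) ≠ 0 ∧
      ∀ S', cellKey S < cellKey S' →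
        diffPairing _ 𝕜 T (derivOp 𝕜 S' (Delta 𝕜 (hook K L) (hook_card K L))) = 0 := by
  obtain ⟨D, rfl⟩ := hS
  obtain ⟨T, hT, hzero⟩ := separates_biexponentDet 𝕜 D
  refine ⟨T, ?_, fun S' hlt => ?_⟩
  · rwa [← cellToken_crossedCells, LinearMap.flip_apply, diffPairing_tailMonomial_mul] at hT
  · obtain ⟨p, hagree, hp⟩ := hlt
    rw [← diffPairing_tailMonomial_mul, ← LinearMap.flip_apply]
    rw [← cellToken_crossedCells] at hzero
    exact hzero _ ⟨p, Nat.zero_le _, fun q _ hq => (toLex.injective (hagree q hq)).symm, hp⟩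

theorem cellKey_injOn (K L : ℕ) : Set.InjOn cellKey (crossedCellSets K L) :=
  fun _ h _ h' heq => cellToken_injOn K L h h' <| funext fun p =>
    toLex.injective (congrFun (toLex.injective heq) p)

theorem mainTheorem1 (𝕜 : Type*) [Field 𝕜] [CharZero 𝕜] (K L : ℕ) :
    LinearIndependent 𝕜 (fun S : crossedCellSets K L =>
      derivOp 𝕜 (S : Finset (DessinCell (K + L))) (Delta 𝕜 (hook K L) (hook_card K L))) := by
  classical
  rw [linearIndependent_iff']
  intro s g hg
  by_contra! hcon
  obtain ⟨i, his, hi⟩ := hcon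
  -- For the smallest key with non-zero coefficient, the separating T kills all other terms of the
  -- relation.
  obtain ⟨S, hS, hmin⟩ := (s.filter fun j => g j ≠ 0).exists_min_image
    (fun j => cellKey (j : Finset (DessinCell (K + L)))) ⟨i, Finset.mem_filter.2 ⟨his, hi⟩⟩
  obtain ⟨hSs, hgS⟩ := Finset.mem_filter.1 hS
  obtain ⟨T, hT, hzero⟩ := exists_separating 𝕜 S.2
  have hsum := congrArg (diffPairing _ 𝕜 T) hg
  rw [map_sum, map_zero, Finset.sum_eq_single_of_mem S hSs] at hsum
  · rw [map_smul, smul_eq_mul] at hsum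
    exact mul_ne_zero hgS hT hsum
  · intro j hj hjS
    by_cases hgj : g j = 0
    · rw [hgj, zero_smul, map_zero]
    · rw [map_smul, hzero, smul_zero]
      refine (hmin j (Finset.mem_filter.2 ⟨hj, hgj⟩)).lt_of_ne fun h => hjS ?_
      exact Subtype.ext (cellKey_injOn K L j.2 S.2 h.symm)
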